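/- **Setting.** Let $\mathbb F$ be a finite field, and let $\mathbb V=V^\diamond\oplus V$ be the space of two-sided sequences $(v_j)_{j\in\mathbb Z}$ in $\mathbb F$ with $v_j=0$ for all sufficiently large $j$; it carries the product topology on the coordinates $j\le 0$ (space $V^\diamond$) and the discrete topology on the sequence of coordinates $j>0$ (space $V$). Let $\overline{\mathrm{GL}}$ be the group of all invertible bicontinuous linear operators of $\mathbb V$ which preserve the Haar measure, with the topology of uniform convergence on compact sets. Unitary representations of $\overline{\mathrm{GL}}$ are assumed to be (strongly) continuous; irreducible means non-zero and without proper non-zero closed invariant subspaces; equivalence is unitary equivalence. For integers $\alpha_-\le\alpha_+$ write $\alpha=(\alpha_-,\alpha_+)$, $|\alpha|=\alpha_+-\alpha_-$, and $\alpha\preceq\beta$ if $\beta_-\le\alpha_-$ and $\alpha_+\le\beta_+$. Let $W_k\subset\mathbb V$ be the subspace $v_j=0$ for all $j>k$. Let $\overline P_\alpha$ be the subgroup of all $g\in\overline{\mathrm{GL}}$ with $gW_{\alpha_-}=W_{\alpha_-}$ and $gW_{\alpha_+}=W_{\alpha_+}$. The action on $W_{\alpha_+}/W_{\alpha_-}$,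 in the basis $e_{\alpha_-+1},\dots,e_{\alpha_+}$, is a homomorphism $\overline P_\alpha\to\mathrm{GL}(|\alpha|,\mathbb F)$; let $\overline Q_\alpha$ be its kernel. For a unitary representation $\rho$ of $\overline{\mathrm{GL}}$ in $H$ let $H_\alpha$ be the space of $\overline Q_\alpha$-fixed vectors, $P_\alpha$ the orthogonal projection onto $H_\alpha$, and $\Xi(\rho)=\{\alpha: H_\alpha\ne 0\}$. Let $\zeta_\alpha\in\overline{\mathrm{GL}}$ be the operator interchanging the coordinates with numbers $\alpha_-$ and $\alpha_++1$. The representation $\rho$ has spherical character $z$ if $P_\alpha\rho(\zeta_\alpha)h=zh$ for all $\alpha$ and all $h\in H_\alpha$. Let $\tau$ be an irreducible unitary representation of $\mathrm{GL}(|\alpha|,\mathbb F)$. An irreducible unitary representation $\rho$ of $\overline{\mathrm{GL}}$ has data $(0,\alpha,\tau)$ if its spherical character is $0$, $\Xi(\rho)=\{\beta:\alpha\preceq\beta\}$, and the representation of $\overline P_\alpha/\overline Q_\alpha\simeq\mathrm{GL}(|\alpha|,\mathbb F)$ in $H_\alpha$ is equivalent to $\tau$. **Proposition.** For every $\alpha$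 and every irreducible unitary representation $\tau$ of $\mathrm{GL}(|\alpha|,\mathbb F)$ in a space $L$, regard $\tau$ as a representation of $\overline P_\alpha$ trivial on $\overline Q_\alpha$, and let $T=\mathrm{Ind}_{\overline P_\alpha}^{\overline{\mathrm{GL}}}\tau$ be the induced representation in $\ell^2(\overline{\mathrm{GL}}/\overline P_\alpha, L)$. Then: 1. the space of $T$ is separable, and $T$ is a continuous irreducible unitary representation of $\overline{\mathrm{GL}}$ with data $(0,\alpha,\tau)$; 2. every irreducible unitary representation of $\overline{\mathrm{GL}}$ with data $(0,\alpha,\tau)$ is equivalent to $T$. Thus the irreducible representation of $\overline{\mathrm{GL}}$ with data $(0,\alpha,\tau)$ is the representation induced from $\tau$. -/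

import Mathlib

open MeasureTheory Topology

noncomputable section

/-! ## The space of two-sided sequences -/

/-- The two-sided sequences `v : ℤ → F` with `v j = 0` for all sufficiently large `j`. -/
def seqSubmodule (F : Type*) [Field F] : Submodule F (ℤ → F) where
  carrier := {v | ∃ N : ℤ, ∀ j, N < j → v j = 0}
  zero_mem' := ⟨0, fun _ _ => rfl⟩
  add_mem' := by
    rintro v w ⟨N, hN⟩ ⟨M, hM⟩
    refine ⟨max N M, fun j hj => ?_⟩
    simp [hN j (lt_of_le_of_lt (le_max_left _ _) hj), hM j (lt_of_le_of_lt (le_max_right _ _) hj)]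
  smul_mem' := by
    rintro c v ⟨N, hN⟩
    exact ⟨N, fun j hj => by simp [hN j hj]⟩

/-- The linear space `𝕍 = V^⋄ ⊕ V`, as a space of two-sided sequences: `V^⋄` corresponds to the
coordinates `j ≤ 0` and `V` to the coordinates `j > 0`. -/
def SeqSpace (F : Type*) [Field F] : Type _ := ↥(seqSubmodule F)

namespace SeqSpace

variable {F : Type*} [Field F]

instance : AddCommGroup (SeqSpace F) := inferInstanceAs (AddCommGroup ↥(seqSubmodule F))
instance : Module F (SeqSpace F) := inferInstanceAs (Module F ↥(seqSubmodule F))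
instance : CoeFun (SeqSpace F) (fun _ => ℤ → F) := ⟨fun v => v.1⟩

@[ext] theorem ext {v w : SeqSpace F} (h : ∀ j, v j = w j) : v = w := Subtype.ext (funext h)
@[simp] theorem add_apply (v w : SeqSpace F) (j : ℤ) : (v + w) j = v j + w j := rfl
@[simp] theorem sub_apply (v w : SeqSpace F) (j : ℤ) : (v - w) j = v j - w j := rfl
@[simp] theorem neg_apply (v : SeqSpace F) (j : ℤ) : (-v) j = - v j := rfl
@[simp] theorem zero_apply (j : ℤ) : (0 : SeqSpace F) j = 0 := rfl
@[simp] theorem smul_apply (c : F) (v : SeqSpace F) (j : ℤ) : (c • v) j = c * v j := rfl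

/-- `W k`: the sequences vanishing at all coordinates `j > k`. -/
def W (F : Type*) [Field F] (k : ℤ) : Submodule F (SeqSpace F) where
  carrier := {v | ∀ j, k < j → v j = 0}
  zero_mem' := fun _ _ => rfl
  add_mem' := fun hv hw j hj => by simp [hv j hj, hw j hj]
  smul_mem' := fun c v hv j hj => by simp [hv j hj]

theorem mem_W {k : ℤ} {v : SeqSpace F} : v ∈ W F k ↔ ∀ j, k < j → v j = 0 := Iff.rfl

/-- The coordinates `j ≤ 0`, as an additive map. -/
def lowPart (F : Type*) [Field F] : SeqSpace F →+ ({j : ℤ // j ≤ 0} → F) :=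
  ⟨⟨fun v j => v j.1, rfl⟩, fun _ _ => rfl⟩

/-- The coordinates `j > 0`, as an additive map. -/
def highPart (F : Type*) [Field F] : SeqSpace F →+ ({j : ℤ // 0 < j} → F) :=
  ⟨⟨fun v j => v j.1, rfl⟩, fun _ _ => rfl⟩

/-- The topology of `V^⋄`: the product topology, where `F` is discrete. -/
abbrev lowTopology (F : Type*) [Field F] : TopologicalSpace ({j : ℤ // j ≤ 0} → F) :=
  @Pi.topologicalSpace _ _ (fun _ => ⊥)

/-- The topology of `V^⋄ ⊕ V`: the product topology on the sequence of coordinates `j ≤ 0`, the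
discrete topology on the sequence of coordinates `j > 0`. -/
instance : TopologicalSpace (SeqSpace F) :=
  TopologicalSpace.induced (lowPart F) (lowTopology F) ⊓ TopologicalSpace.induced (highPart F) ⊥

theorem topology_eq : (inferInstance : TopologicalSpace (SeqSpace F)) =
    TopologicalSpace.induced (lowPart F) (lowTopology F) ⊓
      TopologicalSpace.induced (highPart F) ⊥ := rfl

instance : IsTopologicalAddGroup (SeqSpace F) := by
  have h1 : @IsTopologicalAddGroup (SeqSpace F)
      (TopologicalSpace.induced (lowPart F) (lowTopology F)) _ := by
    let tF : TopologicalSpace F := ⊥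
    have dF : DiscreteTopology F := ⟨rfl⟩
    exact topologicalAddGroup_induced (lowPart F)
  have h2 : @IsTopologicalAddGroup (SeqSpace F) (TopologicalSpace.induced (highPart F) ⊥) _ := by
    let tH : TopologicalSpace ({j : ℤ // 0 < j} → F) := ⊥
    have dH : DiscreteTopology ({j : ℤ // 0 < j} → F) := ⟨rfl⟩
    have gH : IsTopologicalAddGroup ({j : ℤ // 0 < j} → F) :=
      { continuous_add := continuous_of_discreteTopology
        continuous_neg := continuous_of_discreteTopology }
    exact topologicalAddGroup_induced (highPart F)
  exact topologicalAddGroup_inf h1 h2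

theorem isOpen_W (k : ℤ) : IsOpen (W F k : Set (SeqSpace F)) := by
  let tF : TopologicalSpace F := ⊥
  have dF : DiscreteTopology F := ⟨rfl⟩
  have h1 : IsOpen {v : SeqSpace F | highPart F v = 0} :=
    (topology_eq.trans_le inf_le_right) _ ⟨{0}, trivial, rfl⟩
  have h2 : ∀ j : {j : ℤ // j ≤ 0}, IsOpen {v : SeqSpace F | v j.1 = 0} := fun j =>
    (topology_eq.trans_le inf_le_left) _
      ⟨(fun w => w j) ⁻¹' ({0} : Set F), (isOpen_discrete ({0} : Set F)).preimage
        (continuous_apply (A := fun _ : {j : ℤ // j ≤ 0} => F) j), rfl⟩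
  rcases le_total 0 k with hk | hk
  · have h4 : {v : SeqSpace F | highPart F v = 0} ⊆ (W F 0 : Set (SeqSpace F)) := by
      intro v hv j hj
      exact congrFun hv ⟨j, hj⟩
    have h5 : W F 0 ≤ W F k := fun v hv j hj => hv j (lt_of_le_of_lt hk hj)
    refine AddSubgroup.isOpen_of_mem_nhds (W F k).toAddSubgroup (g := 0) ?_
    exact Filter.mem_of_superset (h1.mem_nhds (by simp)) (h4.trans h5)
  · have h3 : IsOpen ({v : SeqSpace F | highPart F v = 0} ∩
        ⋂ j ∈ Finset.Ioc k 0, {v : SeqSpace F | v j = 0}) := by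
      refine h1.inter ?_
      refine isOpen_biInter_finset fun j hj => h2 ⟨j, (Finset.mem_Ioc.1 hj).2⟩
    convert h3
    ext v
    simp only [SetLike.mem_coe, Set.mem_inter_iff, Set.mem_ofPred_eq, Set.mem_iInter,
      Finset.mem_Ioc, mem_W]
    constructor
    · intro h
      exact ⟨funext fun j => h j.1 (lt_of_le_of_lt hk j.2), fun j hj => h j hj.1⟩
    · rintro ⟨ha, hb⟩ j hj
      rcases le_or_gt j 0 with h0 | h0
      · exact hb j ⟨hj, h0⟩
      · exact congrFun ha ⟨j, h0⟩

/-- The subgroups `W k` form a basis of neighbourhoods of zero. -/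
theorem hasBasis_nhds_zero :
    (𝓝 (0 : SeqSpace F)).HasBasis (fun _ : ℤ => True) (fun k => (W F k : Set (SeqSpace F))) := by
  let tF : TopologicalSpace F := ⊥
  have dF : DiscreteTopology F := ⟨rfl⟩
  refine ⟨fun U => ⟨fun hU => ?_, fun ⟨k, _, hk⟩ =>
    Filter.mem_of_superset ((isOpen_W k).mem_nhds (zero_mem _)) hk⟩⟩
  have hn : 𝓝 (0 : SeqSpace F) = _ := nhds_inf
    (t₁ := TopologicalSpace.induced (lowPart F) (lowTopology F))
    (t₂ := TopologicalSpace.induced (highPart F) ⊥)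
  rw [hn, @nhds_induced _ _ (lowTopology F), @nhds_induced _ _ ⊥] at hU
  obtain ⟨A, ⟨A', hA', hA⟩, B, ⟨B', hB', hB⟩, rfl⟩ := hU
  rw [map_zero] at hA' hB'
  have hB0 : (0 : {j : ℤ // 0 < j} → F) ∈ B' := by
    have := @mem_of_mem_nhds _ ⊥ _ _ hB'
    exact this
  erw [nhds_pi, Filter.mem_pi] at hA'
  obtain ⟨I, hI, t, ht, hs⟩ := hA'
  obtain ⟨m, hm⟩ : ∃ m : ℤ, m ≤ 0 ∧ ∀ j ∈ I, m < j.1 := by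
    obtain ⟨b, hb⟩ := (hI.image Subtype.val).bddBelow
    refine ⟨min 0 (b - 1), min_le_left _ _, fun j hj => ?_⟩
    have := hb ⟨j, hj, rfl⟩
    have := min_le_right 0 (b - 1)
    omega
  refine ⟨m, trivial, fun v hv => ⟨hA ?_, hB ?_⟩⟩
  · refine hs fun j hj => ?_
    have : lowPart F v j = 0 := hv j.1 (hm.2 j hj)
    rw [this]
    exact mem_of_mem_nhds (ht j)
  · have : highPart F v = 0 := funext fun j => hv j.1 (lt_of_le_of_lt hm.1 j.2)
    change highPart F v ∈ B'
    rwa [this]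

theorem isCompact_W_zero [Finite F] : IsCompact (W F 0 : Set (SeqSpace F)) := by
  let tF : TopologicalSpace F := ⊥
  have dF : DiscreteTopology F := ⟨rfl⟩
  let e : ({j : ℤ // j ≤ 0} → F) → SeqSpace F := fun w =>
    ⟨fun j => if h : j ≤ 0 then w ⟨j, h⟩ else 0, 0, fun j hj => by simp [not_le.2 hj]⟩
  have hlow : ∀ w, lowPart F (e w) = w := fun w => by
    ext j
    change (if h : j.1 ≤ 0 then w ⟨j.1, h⟩ else 0) = w j
    simp [j.2]
  have hhigh : ∀ w, highPart F (e w) = 0 := fun w => by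
    ext j
    change (if h : j.1 ≤ 0 then w ⟨j.1, h⟩ else 0) = 0
    simp [not_le.2 j.2]
  have he : Continuous e := by
    refine continuous_inf_rng.2 ⟨continuous_induced_rng.2 ?_, continuous_induced_rng.2 ?_⟩
    · have : (lowPart F) ∘ e = id := funext hlow
      rw [this]
      exact continuous_id
    · have : (highPart F) ∘ e = fun _ => 0 := funext hhigh
      rw [this]
      exact @continuous_const _ _ _ ⊥ _
  have hr : (W F 0 : Set (SeqSpace F)) = Set.range e := by
    ext v
    constructor
    · intro hv
      refine ⟨lowPart F v, ?_⟩
      ext j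
      change (if h : j ≤ 0 then v j else 0) = v j
      split_ifs with h
      · rfl
      · exact (hv j (not_le.1 h)).symm
    · rintro ⟨w, rfl⟩ j hj
      exact congrFun (hhigh w) ⟨j, hj⟩
  rw [hr]
  exact isCompact_range he

instance [Finite F] : LocallyCompactSpace (SeqSpace F) :=
  isCompact_W_zero.locallyCompactSpace_of_mem_nhds_of_addGroup
    ((isOpen_W (F := F) 0).mem_nhds (zero_mem _))

instance : MeasurableSpace (SeqSpace F) := borel _
instance : BorelSpace (SeqSpace F) := ⟨rfl⟩

/-- The standard basis vector `e j`. -/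
def basisVec (F : Type*) [Field F] (j : ℤ) : SeqSpace F :=
  ⟨Pi.single j 1, j, fun _ hi => Pi.single_eq_of_ne hi.ne' 1⟩

/-- The operator interchanging the coordinates with numbers `a` and `b`. -/
def swapOp (F : Type*) [Field F] (a b : ℤ) : SeqSpace F ≃L[F] SeqSpace F :=
  let f : SeqSpace F →ₗ[F] SeqSpace F :=
    { toFun := fun v => ⟨fun j => v (Equiv.swap a b j), by
        obtain ⟨N, hN⟩ := v.2
        refine ⟨max N (max a b), fun j hj => ?_⟩
        simp only [max_lt_iff] at hj
        change v (Equiv.swap a b j) = 0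
        rw [Equiv.swap_apply_of_ne_of_ne hj.2.1.ne' hj.2.2.ne']
        exact hN j hj.1⟩
      map_add' := fun _ _ => rfl
      map_smul' := fun _ _ => rfl }
  have hf : ∀ v, f (f v) = v := fun v => by
    ext j
    change v (Equiv.swap a b (Equiv.swap a b j)) = v j
    rw [Equiv.swap_apply_self]
  have hc : Continuous f := by
    refine continuous_of_continuousAt_zero f.toAddMonoidHom ?_
    rw [ContinuousAt, map_zero]
    refine (hasBasis_nhds_zero.tendsto_iff hasBasis_nhds_zero).2 fun k _ =>
      ⟨min k (min a b - 1), trivial, fun v hv j hj => ?_⟩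
    refine hv _ ?_
    rw [Equiv.swap_apply_def]
    split_ifs <;> omega
  { LinearEquiv.ofInvolutive f hf with
    continuous_toFun := hc
    continuous_invFun := hc }

@[simp] theorem swapOp_apply (a b : ℤ) (v : SeqSpace F) (j : ℤ) :
    (swapOp F a b v) j = v (Equiv.swap a b j) := rfl

end SeqSpace

open SeqSpace

/-! ## The group of continuous linear operators preserving the Haar measure -/

/-- The group of all invertible continuous linear operators (with continuous inverse) of `𝕍`
which preserve the Haar measure of the locally compact group `𝕍`. -/
def GLbar (F : Type*) [Field F] [Finite F] : Subgroup (SeqSpace F ≃L[F] SeqSpace F) where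
  carrier := {g | (Measure.addHaar : Measure (SeqSpace F)).map g = Measure.addHaar}
  one_mem' := Measure.map_id
  mul_mem' := by
    intro g h hg hh
    change Measure.map (g ∘ h) _ = _
    rw [← Measure.map_map g.continuous.measurable h.continuous.measurable]
    exact (congrArg _ hh).trans hg
  inv_mem' := by
    intro g hg
    change Measure.map g.symm _ = _
    conv_lhs => rw [← show Measure.map g _ = Measure.addHaar from hg]
    rw [Measure.map_map g.symm.continuous.measurable g.continuous.measurable]
    have : g.symm ∘ g = id := funext fun v => g.symm_apply_apply v
    rw [this, Measure.map_id]

variable {F : Type*} [Field F] [Finite F]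

theorem mem_GLbar {g : SeqSpace F ≃L[F] SeqSpace F} :
    g ∈ GLbar F ↔ (Measure.addHaar : Measure (SeqSpace F)).map g = Measure.addHaar := Iff.rfl

/-- The topology of uniform convergence on compact sets (the compact-open topology). -/
instance : TopologicalSpace (GLbar F) :=
  TopologicalSpace.induced (fun g => (⟨g.1, g.1.continuous⟩ : C(SeqSpace F, SeqSpace F)))
    inferInstance

theorem swapOp_mem (a b : ℤ) : swapOp F a b ∈ GLbar F := by
  let e : SeqSpace F ≃ₜ+ SeqSpace F := (swapOp F a b).toContinuousAddEquiv
  have h1 : e.trans e = ContinuousAddEquiv.refl _ := by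
    ext v j
    change v (Equiv.swap a b (Equiv.swap a b j)) = v j
    rw [Equiv.swap_apply_self]
  have h2 : addEquivAddHaarChar e * addEquivAddHaarChar e = 1 := by
    rw [← addEquivAddHaarChar_trans, h1, addEquivAddHaarChar_refl]
  have h3 : addEquivAddHaarChar e = 1 := by
    exact (pow_eq_one_iff_of_nonneg zero_le two_ne_zero).1 (by rw [pow_two, h2])
  have h4 := addEquivAddHaarChar_smul_map (Measure.addHaar : Measure (SeqSpace F)) e
  rw [h3, one_smul] at h4
  exact h4

/-! ## Segments and the subgroups `P̄_α`, `Q̄_α` -/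

/-- A pair `α = (lo, hi)` of integers with `lo ≤ hi`. -/
structure Seg where
  lo : ℤ
  hi : ℤ
  le : lo ≤ hi

namespace Seg

/-- The partial order on pairs: `[lo, hi]` of the smaller pair lies in `[lo, hi]` of the larger. -/
instance : PartialOrder Seg where
  le β α := α.lo ≤ β.lo ∧ β.hi ≤ α.hi
  le_refl _ := ⟨le_rfl, le_rfl⟩
  le_trans _ _ _ h h' := ⟨h'.1.trans h.1, h.2.trans h'.2⟩
  le_antisymm := by
    rintro ⟨a, b, h⟩ ⟨c, d, h'⟩ ⟨h1, h2⟩ ⟨h3, h4⟩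
    obtain rfl : a = c := le_antisymm h3 h1
    obtain rfl : b = d := le_antisymm h2 h4
    rfl

theorem le_iff {β α : Seg} : β ≤ α ↔ α.lo ≤ β.lo ∧ β.hi ≤ α.hi := Iff.rfl

/-- `|α| = hi - lo`. -/
def len (α : Seg) : ℕ := (α.hi - α.lo).toNat

/-- The `i`-th integer of the segment `lo + 1, …, hi`. -/
def idx (α : Seg) (i : Fin α.len) : ℤ := α.lo + 1 + i

theorem idx_mem (α : Seg) (i : Fin α.len) : α.lo < α.idx i ∧ α.idx i ≤ α.hi := by
  have := i.2
  have := α.le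
  unfold len at *
  unfold idx
  omega

theorem exists_idx (α : Seg) {j : ℤ} (h1 : α.lo < j) (h2 : j ≤ α.hi) : ∃ i, α.idx i = j := by
  refine ⟨⟨(j - α.lo - 1).toNat, ?_⟩, ?_⟩
  · unfold len
    omega
  · unfold idx
    push_cast
    omega

theorem idx_injective (α : Seg) : Function.Injective α.idx := by
  intro i j h
  unfold idx at h
  ext
  omega

end Seg

/-- The subgroup `P̄_α` of block upper triangular operators: those which map the subspaces
`W α.lo ⊆ W α.hi` onto themselves. -/
def Pbar (F : Type*) [Field F] [Finite F] (α : Seg) : Subgroup (GLbar F) where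
  carrier := {g | (W F α.lo).map g.1.toLinearMap = W F α.lo ∧
    (W F α.hi).map g.1.toLinearMap = W F α.hi}
  one_mem' := ⟨Submodule.map_id _, Submodule.map_id _⟩
  mul_mem' := by
    rintro g h ⟨hg1, hg2⟩ ⟨hh1, hh2⟩
    have key : ∀ S : Submodule F (SeqSpace F), S.map (g * h).1.toLinearMap =
        (S.map h.1.toLinearMap).map g.1.toLinearMap := fun S =>
      Submodule.map_comp (h.1.toLinearMap) (g.1.toLinearMap) S
    exact ⟨by rw [key, hh1, hg1], by rw [key, hh2, hg2]⟩
  inv_mem' := by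
    rintro g ⟨hg1, hg2⟩
    have key : ∀ S : Submodule F (SeqSpace F), S.map g.1.toLinearMap = S →
        S.map (g⁻¹).1.toLinearMap = S := fun S hS => by
      conv_lhs => rw [← hS]
      rw [← Submodule.map_comp]
      have : (g⁻¹).1.toLinearMap.comp g.1.toLinearMap = LinearMap.id :=
        LinearMap.ext fun v => g.1.symm_apply_apply v
      rw [this, Submodule.map_id]
    exact ⟨key _ hg1, key _ hg2⟩

theorem mem_Pbar {α : Seg} {g : GLbar F} : g ∈ Pbar F α ↔
    (W F α.lo).map g.1.toLinearMap = W F α.lo ∧ (W F α.hi).map g.1.toLinearMap = W F α.hi :=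
  Iff.rfl

theorem Pbar_lo {α : Seg} {g : GLbar F} (hg : g ∈ Pbar F α) {v : SeqSpace F}
    (hv : v ∈ W F α.lo) : g.1 v ∈ W F α.lo := by
  rw [← hg.1]
  exact ⟨v, hv, rfl⟩

theorem Pbar_hi {α : Seg} {g : GLbar F} (hg : g ∈ Pbar F α) {v : SeqSpace F}
    (hv : v ∈ W F α.hi) : g.1 v ∈ W F α.hi := by
  rw [← hg.2]
  exact ⟨v, hv, rfl⟩

theorem basisVec_apply {F : Type*} [Field F] (i j : ℤ) : (basisVec F i) j = if j = i then 1 else 0 := by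
  change (Pi.single i 1 : ℤ → F) j = _
  rw [Pi.single_apply]

/-- The middle block `a₂₂` of the matrix of an operator, of size `|α| × |α|`, in the basis
`e (lo + 1), …, e hi`. -/
def midBlock (α : Seg) (g : GLbar F) : Matrix (Fin α.len) (Fin α.len) F :=
  Matrix.of fun i j => (g.1 (basisVec F (α.idx j))) (α.idx i)

theorem sub_sum_mem {F : Type*} [Field F] (α : Seg) {v : SeqSpace F} (hv : v ∈ W F α.hi) :
    v - ∑ k, v (α.idx k) • basisVec F (α.idx k) ∈ W F α.lo := by
  have hs : ∀ (s : Finset (Fin α.len)) (f : Fin α.len → SeqSpace F) (j : ℤ),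
      (∑ k ∈ s, f k) j = ∑ k ∈ s, (f k) j := fun s f j =>
    map_sum (⟨⟨fun v : SeqSpace F => v j, rfl⟩, fun _ _ => rfl⟩ : SeqSpace F →+ F) f s
  intro j hj
  rw [SeqSpace.sub_apply, hs]
  simp only [SeqSpace.smul_apply, basisVec_apply]
  by_cases h : j ≤ α.hi
  · obtain ⟨i, rfl⟩ := α.exists_idx hj h
    simp [α.idx_injective.eq_iff]
  · rw [hv j (not_le.1 h), Finset.sum_eq_zero, sub_zero]
    intro k _
    have := (α.idx_mem k).2
    rw [if_neg (by omega), mul_zero]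

theorem midBlock_mul {α : Seg} (g h : GLbar F) (hg : g ∈ Pbar F α) (hh : h ∈ Pbar F α) :
    midBlock α (g * h) = midBlock α g * midBlock α h := by
  ext i j
  have hb : basisVec F (α.idx j) ∈ W F α.hi := fun k hk => by
    have := (α.idx_mem j).2
    rw [basisVec_apply, if_neg (by omega)]
  have h1 := Pbar_lo hg (sub_sum_mem α (Pbar_hi hh hb)) (α.idx i) (α.idx_mem i).1
  have hs : ∀ (s : Finset (Fin α.len)) (f : Fin α.len → SeqSpace F) (j : ℤ),
      (∑ k ∈ s, f k) j = ∑ k ∈ s, (f k) j := fun s f j =>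
    map_sum (⟨⟨fun v : SeqSpace F => v j, rfl⟩, fun _ _ => rfl⟩ : SeqSpace F →+ F) f s
  rw [map_sub, map_sum, SeqSpace.sub_apply, hs, sub_eq_zero] at h1
  rw [Matrix.mul_apply]
  change (g.1 (h.1 (basisVec F (α.idx j)))) (α.idx i) = _
  rw [h1]
  refine Finset.sum_congr rfl fun k _ => ?_
  rw [map_smul, SeqSpace.smul_apply, mul_comm]
  rfl

/-- The homomorphism `P̄_α → GL(|α|, F)` sending a block upper triangular operator to its middle
block. -/
def blockHom (F : Type*) [Field F] [Finite F] (α : Seg) : Pbar F α →* GL (Fin α.len) F :=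
  MonoidHom.toHomUnits
    { toFun := fun g => midBlock α g.1
      map_one' := by
        ext i j
        change (basisVec F (α.idx j)) (α.idx i) = _
        rw [basisVec_apply, Matrix.one_apply]
        simp [α.idx_injective.eq_iff]
      map_mul' := fun g h => midBlock_mul g.1 h.1 g.2 h.2 }

/-- The subgroup `Q̄_α`: block upper triangular operators with the unit middle block. -/
def Qbar (F : Type*) [Field F] [Finite F] (α : Seg) : Subgroup (GLbar F) :=
  (blockHom F α).ker.map (Pbar F α).subtype

/-- The element with matrix `(0 0 1; 0 1_{|α|} 0; 1 0 0)` (bordered by units), the middle block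
being in the positions `lo + 1, …, hi`: it interchanges the coordinates `lo` and `hi + 1`. -/
def zetaElt (F : Type*) [Field F] [Finite F] (α : Seg) : GLbar F :=
  ⟨swapOp F α.lo (α.hi + 1), swapOp_mem _ _⟩

/-! ## Unitary representations -/

section Representations

variable {G : Type*} [Group G]
  {H : Type*} [NormedAddCommGroup H] [InnerProductSpace ℂ H]
  {H' : Type*} [NormedAddCommGroup H'] [InnerProductSpace ℂ H']

/-- A unitary representation `ρ` of a topological group is (strongly) continuous. -/
def IsStronglyContinuous [TopologicalSpace G] (ρ : G →* (H ≃ₗᵢ[ℂ] H)) : Prop :=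
  ∀ h : H, Continuous fun g => ρ g h

/-- A unitary representation is irreducible if its space is non-zero and there are no closed
invariant subspaces except `0` and the whole space. -/
def IsIrreducibleRep (ρ : G →* (H ≃ₗᵢ[ℂ] H)) : Prop :=
  Nontrivial H ∧ ∀ S : Submodule ℂ H, IsClosed (S : Set H) →
    (∀ g, ∀ v ∈ S, ρ g v ∈ S) → S = ⊥ ∨ S = ⊤

/-- Unitary equivalence of unitary representations. -/
def UnitarilyEquivalent (ρ : G →* (H ≃ₗᵢ[ℂ] H)) (ρ' : G →* (H' ≃ₗᵢ[ℂ] H')) : Prop :=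
  ∃ U : H ≃ₗᵢ[ℂ] H', ∀ g v, U (ρ g v) = ρ' g (U v)

/-- The subspace of vectors fixed by a subgroup. -/
def fixedVectors (ρ : G →* (H ≃ₗᵢ[ℂ] H)) (K : Subgroup G) : Submodule ℂ H where
  carrier := {v | ∀ g ∈ K, ρ g v = v}
  zero_mem' := fun g _ => map_zero _
  add_mem' := fun hv hw g hg => by rw [map_add, hv g hg, hw g hg]
  smul_mem' := fun c v hv g hg => by rw [map_smul, hv g hg]

theorem mem_fixedVectors {ρ : G →* (H ≃ₗᵢ[ℂ] H)} {K : Subgroup G} {v : H} :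
    v ∈ fixedVectors ρ K ↔ ∀ g ∈ K, ρ g v = v := Iff.rfl

theorem isClosed_fixedVectors (ρ : G →* (H ≃ₗᵢ[ℂ] H)) (K : Subgroup G) :
    IsClosed (fixedVectors ρ K : Set H) := by
  have : (fixedVectors ρ K : Set H) = ⋂ g ∈ K, {v | ρ g v = v} := by
    ext v
    simp [mem_fixedVectors]
  rw [this]
  exact isClosed_biInter fun g _ => isClosed_eq (ρ g).continuous continuous_id

instance [CompleteSpace H] (ρ : G →* (H ≃ₗᵢ[ℂ] H)) (K : Subgroup G) :
    CompleteSpace (fixedVectors ρ K) := (isClosed_fixedVectors ρ K).completeSpace_coe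

end Representations

/-! ## Induced representations -/

section Induced

variable {G : Type*} [Group G] (P : Subgroup G)
  {L : Type*} [NormedAddCommGroup L] [InnerProductSpace ℂ L] (τ : P →* (L ≃ₗᵢ[ℂ] L))

open Classical in
/-- A choice of representatives of the cosets `g P`, equal to `1` for the coset `P`. -/
def cosetRep (x : G ⧸ P) : G := if x = ((1 : G) : G ⧸ P) then 1 else x.out

theorem mk_cosetRep (x : G ⧸ P) : ((cosetRep P x : G) : G ⧸ P) = x := by
  unfold cosetRep
  split_ifs with h
  · exact h.symm
  · exact QuotientGroup.out_eq' x

/-- The element `s(x)⁻¹ g s(g⁻¹ x)` of `P`, where `s` is the choice of representatives. -/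
def cosetCocycle (g : G) (x : G ⧸ P) : P :=
  ⟨(cosetRep P x)⁻¹ * (g * cosetRep P (g⁻¹ • x)), by
    rw [← QuotientGroup.eq, mk_cosetRep]
    change x = g • ((cosetRep P (g⁻¹ • x) : G) : G ⧸ P)
    rw [mk_cosetRep, smul_inv_smul]⟩

theorem cosetCocycle_one (x : G ⧸ P) : cosetCocycle P 1 x = 1 := by
  ext
  simp [cosetCocycle]

theorem cosetCocycle_mul (g h : G) (x : G ⧸ P) :
    cosetCocycle P (g * h) x = cosetCocycle P g x * cosetCocycle P h (g⁻¹ • x) := by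
  ext
  simp [cosetCocycle, mul_assoc, mul_smul]

/-- The Hilbert space `ℓ²(G / P, L)` of the induced representation. -/
abbrev IndSpace (P : Subgroup G) (L : Type*) [NormedAddCommGroup L] : Type _ :=
  lp (fun _ : G ⧸ P => L) 2

theorem induced_hasSum (g : G) (f : IndSpace P L) :
    HasSum (fun x => ‖τ (cosetCocycle P g x) (f (g⁻¹ • x))‖ ^ (2 : ENNReal).toReal)
      (‖f‖ ^ (2 : ENNReal).toReal) := by
  simp only [LinearIsometryEquiv.norm_map]
  exact (MulAction.toPerm (g⁻¹ : G) : Equiv.Perm (G ⧸ P)).hasSum_iff.2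
    (lp.hasSum_norm (by norm_num) f)

/-- The operator `(T(g) f)(x) = τ(s(x)⁻¹ g s(g⁻¹ x)) f(g⁻¹ x)` in `ℓ²(G / P, L)`. -/
def inducedFun (g : G) (f : IndSpace P L) : IndSpace P L :=
  ⟨fun x => τ (cosetCocycle P g x) (f (g⁻¹ • x)), memℓp_gen (induced_hasSum P τ g f).summable⟩

@[simp] theorem inducedFun_apply (g : G) (f : IndSpace P L) (x : G ⧸ P) :
    inducedFun P τ g f x = τ (cosetCocycle P g x) (f (g⁻¹ • x)) := rfl

theorem inducedFun_one (f : IndSpace P L) : inducedFun P τ 1 f = f := by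
  ext x
  simp [cosetCocycle_one]

theorem inducedFun_mul (g h : G) (f : IndSpace P L) :
    inducedFun P τ (g * h) f = inducedFun P τ g (inducedFun P τ h f) := by
  ext x
  simp [cosetCocycle_mul, mul_smul]

/-- The unitary representation of `G` induced from the unitary representation `τ` of `P`. The
group `P` acts on functions supported by the initial coset `P` through `τ`. -/
def inducedRep : G →* (IndSpace P L ≃ₗᵢ[ℂ] IndSpace P L) where
  toFun g :=
    { toFun := inducedFun P τ g
      invFun := inducedFun P τ g⁻¹
      map_add' := fun f f' => by
        ext x
        simp
      map_smul' := fun c f => by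
        ext x
        simp
      left_inv := fun f => by rw [← inducedFun_mul, inv_mul_cancel, inducedFun_one]
      right_inv := fun f => by rw [← inducedFun_mul, mul_inv_cancel, inducedFun_one]
      norm_map' := fun f => by
        have h1 := lp.norm_rpow_eq_tsum (p := 2) (by norm_num) (inducedFun P τ g f)
        have h2 := (induced_hasSum P τ g f).tsum_eq
        have h3 := h1.trans h2
        exact (Real.rpow_left_inj (norm_nonneg _) (norm_nonneg _) (by norm_num)).1 h3 }
  map_one' := by
    ext f : 1
    exact inducedFun_one P τ f
  map_mul' g h := by
    ext f : 1
    exact inducedFun_mul P τ g h f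

theorem inducedRep_apply (g : G) (f : IndSpace P L) (x : G ⧸ P) :
    inducedRep P τ g f x = τ (cosetCocycle P g x) (f (g⁻¹ • x)) := rfl

end Induced

/-! ## The data of an irreducible representation with zero spherical character -/

section Data

variable {H : Type*} [NormedAddCommGroup H] [InnerProductSpace ℂ H]
  {L : Type*} [NormedAddCommGroup L] [InnerProductSpace ℂ L]

/-- The set `Ξ(ρ)` of all `α` such that there are non-zero `Q̄_α`-fixed vectors. -/
def Xi (ρ : GLbar F →* (H ≃ₗᵢ[ℂ] H)) : Set Seg := {α | fixedVectors ρ (Qbar F α) ≠ ⊥}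

/-- The representation `ρ` has spherical character `z`: for each `α` the operator `P_α ρ(ζ)` on
the space `H_α` of `Q̄_α`-fixed vectors is the multiplication by `z`; here `P_α` is the orthogonal
projection to `H_α`, and `ζ` is the matrix `(0 0 1; 0 1_{|α|} 0; 1 0 0)`. -/
def HasSphericalCharacter [CompleteSpace H] (ρ : GLbar F →* (H ≃ₗᵢ[ℂ] H)) (z : ℝ) : Prop :=
  ∀ α : Seg, ∀ h ∈ fixedVectors ρ (Qbar F α),
    (fixedVectors ρ (Qbar F α)).starProjection (ρ (zetaElt F α) h) = (z : ℂ) • h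

/-- The representation `ρ` has data `(0, α, τ)`: its spherical character is `0`, the set `Ξ(ρ)`
consists of all `β ≥ α`, and the representation of `P̄_α / Q̄_α = GL(|α|, F)` in the space of
`Q̄_α`-fixed vectors is equivalent to `τ`. -/
structure HasZeroData [CompleteSpace H] (ρ : GLbar F →* (H ≃ₗᵢ[ℂ] H)) (α : Seg)
    (τ : GL (Fin α.len) F →* (L ≃ₗᵢ[ℂ] L)) : Prop where
  spherical : HasSphericalCharacter ρ 0
  xi_eq : Xi ρ = {β | α ≤ β}
  equiv : ∃ U : L ≃ₗᵢ[ℂ] fixedVectors ρ (Qbar F α),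
    ∀ (p : Pbar F α) (v : L), ((U (τ (blockHom F α p) v) : _) : H) = ρ p.1 (U v : H)

/-- The representation induced from `τ`, regarded as a representation of `P̄_α` trivial on
`Q̄_α`. -/
def inducedFromBlock (α : Seg) (τ : GL (Fin α.len) F →* (L ≃ₗᵢ[ℂ] L)) :
    GLbar F →* (IndSpace (Pbar F α) L ≃ₗᵢ[ℂ] IndSpace (Pbar F α) L) :=
  inducedRep (Pbar F α) (τ.comp (blockHom F α))

end Data

end

/-! A coset g P̄_α is the flag gW_lo ⊂ gW_hi, so T acts on square-summable L-valued functions on the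
orbit of such flags. Measure preservation makes this orbit rigid. A complement of one open subspace
in a larger one, when finite, has a cardinality determined by the two volumes. Hence gW_k ⊂ W_k
forces equality, and gW_a ⊂ W_b forces a ≤ b.

Properties of T. The norm of a Q̄_β-fixed function is constant on Q̄_β-orbits, so the function
vanishes at every point with an infinite orbit. Explicit shears show that only flags with W_{β.lo} ⊂
gW_{α.lo} and gW_{α.hi} ⊂ W_{β.hi} can survive (`between_of_apply_ne_zero`). For β = α rigidity
leaves just the base point, so H_α is a copy of τ. For general β it gives α ≤ β. The support
condition also separates ζ_β f from f' for any fixed f, f', so the spherical character is 0. Since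
Q̄_α fixes exactly the functions supported at the base point, a closed invariant subspace is
controlled by its part in that copy of L, and T is irreducible.

Uniqueness. Let ρ have the given data. By irreducibility it suffices that ρ(g)H_α ⊥ H_α for g ∉ P̄_α
(`inner_eq_zero_of_notMem_Pbar`), for then ρ is the Hilbert sum of the translates of H_α over the
cosets. If gW_hi ≠ W_hi or gW_lo ≠ W_lo, apply to ρ(g)h a sequence of operators pushing the unwanted
coordinates to +∞ or −∞ while fixing a suitable translate of the second vector. A weak limit point
has the same inner product with that vector, yet it is fixed by some Q̄_β with β.hi = α.hi − 1 or
β.lo = α.lo + 1. Such β are not in Ξ(ρ), so the limit is zero. -/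

noncomputable section

open SeqSpace

namespace SeqSpace

/-! ### Truncations, complements of the subspaces `W k`, and compactness. -/

section Coordinates

variable {F : Type*} [Field F]

/-- The `j`-th coordinate as a linear functional. -/
def coord (F : Type*) [Field F] (j : ℤ) : SeqSpace F →ₗ[F] F where
  toFun v := v j
  map_add' _ _ := rfl
  map_smul' _ _ := rfl

@[simp] theorem coord_apply (j : ℤ) (v : SeqSpace F) : coord F j v = v j := rfl

@[simp] theorem sum_apply {ι : Type*} (s : Finset ι) (f : ι → SeqSpace F) (j : ℤ) :
    (∑ i ∈ s, f i) j = ∑ i ∈ s, (f i) j :=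
  map_sum (coord F j) f s

@[simp] theorem basisVec_same (j : ℤ) : (basisVec F j) j = 1 := by
  simp [basisVec_apply]

theorem basisVec_of_ne {i j : ℤ} (h : i ≠ j) : (basisVec F j) i = 0 := by
  simp [basisVec_apply, h]

theorem basisVec_mem_W {j k : ℤ} : basisVec F j ∈ W F k ↔ j ≤ k := by
  refine ⟨fun h => ?_, fun h i hi => basisVec_of_ne (by omega)⟩
  by_contra hjk
  simpa using h j (not_le.1 hjk)

theorem W_mono {k l : ℤ} (h : k ≤ l) : W F k ≤ W F l := fun _ hv j hj => hv j (h.trans_lt hj)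

theorem exists_mem_W (v : SeqSpace F) : ∃ k, v ∈ W F k := v.2

/-- The sequences vanishing at all coordinates `j ≤ k`. -/
def Phi (F : Type*) [Field F] (k : ℤ) : Submodule F (SeqSpace F) where
  carrier := {v | ∀ j, j ≤ k → v j = 0}
  zero_mem' := fun _ _ => rfl
  add_mem' := fun hv hw j hj => by simp [hv j hj, hw j hj]
  smul_mem' := fun c v hv j hj => by simp [hv j hj]

theorem Phi_anti {k l : ℤ} (h : k ≤ l) : Phi F l ≤ Phi F k := fun _ hv j hj => hv j (hj.trans h)

/-- Truncation of a sequence to the coordinates `j ≤ k`. -/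
def low (F : Type*) [Field F] (k : ℤ) : SeqSpace F →ₗ[F] SeqSpace F where
  toFun v := ⟨fun j => if j ≤ k then v j else 0, k, fun j hj => if_neg (not_le.2 hj)⟩
  map_add' v w := by
    ext j
    change (if j ≤ k then v j + w j else 0) = (if j ≤ k then v j else 0) + if j ≤ k then w j else 0
    split_ifs <;> simp
  map_smul' c v := by
    ext j
    change (if j ≤ k then c * v j else 0) = c * if j ≤ k then v j else 0
    split_ifs <;> simp

@[simp] theorem low_apply (k : ℤ) (v : SeqSpace F) (j : ℤ) :
    (low F k v) j = if j ≤ k then v j else 0 := rfl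

/-- Truncation of a sequence to the coordinates `j > k`. -/
def high (F : Type*) [Field F] (k : ℤ) : SeqSpace F →ₗ[F] SeqSpace F := LinearMap.id - low F k

@[simp] theorem high_apply (k : ℤ) (v : SeqSpace F) (j : ℤ) :
    (high F k v) j = if j ≤ k then 0 else v j := by
  change v j - (low F k v) j = _
  rw [low_apply]
  split_ifs <;> simp

theorem low_mem_W (k : ℤ) (v : SeqSpace F) : low F k v ∈ W F k := fun j hj => by
  simp [not_le.2 hj]

theorem high_mem_Phi (k : ℤ) (v : SeqSpace F) : high F k v ∈ Phi F k := fun j hj => by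
  simp [hj]

theorem low_add_high (k : ℤ) (v : SeqSpace F) : low F k v + high F k v = v := by
  simp [high]

theorem low_of_mem_W {k : ℤ} {v : SeqSpace F} (h : v ∈ W F k) : low F k v = v := by
  ext j
  rw [low_apply]
  split_ifs with hj
  · rfl
  · exact (h j (not_le.1 hj)).symm

theorem high_of_mem_W {k : ℤ} {v : SeqSpace F} (h : v ∈ W F k) : high F k v = 0 := by
  simp [high, low_of_mem_W h]

theorem high_of_mem_Phi {k : ℤ} {v : SeqSpace F} (h : v ∈ Phi F k) : high F k v = v := by
  ext j
  rw [high_apply]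
  split_ifs with hj
  · exact (h j hj).symm
  · rfl

theorem low_of_mem_Phi {k : ℤ} {v : SeqSpace F} (h : v ∈ Phi F k) : low F k v = 0 := by
  have := low_add_high k v
  rwa [high_of_mem_Phi h, add_eq_right] at this

theorem high_mem_W {k l : ℤ} {v : SeqSpace F} (h : v ∈ W F l) : high F k v ∈ W F l := fun j hj => by
  simp [h j hj]

theorem eq_zero_of_mem_W_of_mem_Phi {k : ℤ} {v : SeqSpace F} (h : v ∈ W F k) (h' : v ∈ Phi F k) :
    v = 0 := by
  rw [← low_of_mem_W h, low_of_mem_Phi h']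

/-- A subspace of a `W l` meeting some `W k` trivially is finite. -/
theorem finite_of_inf_W_eq_bot [Finite F] {Z : Submodule F (SeqSpace F)} {k l : ℤ}
    (h : ∀ v ∈ Z, v ∈ W F k → v = 0) (hl : Z ≤ W F l) : Finite Z := by
  let f : Z →ₗ[F] (Set.Ioc k l → F) := LinearMap.pi fun j => (coord F j).comp Z.subtype
  refine Finite.of_injective f ((injective_iff_map_eq_zero f).2 fun v hv => ?_)
  refine Subtype.ext (h v.1 v.2 fun j hj => ?_)
  rcases le_or_gt j l with h1 | h1
  · exact congrFun hv ⟨j, hj, h1⟩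
  · exact hl v.2 j h1

instance [Finite F] (k l : ℤ) : Finite (Phi F k ⊓ W F l : Submodule F (SeqSpace F)) :=
  finite_of_inf_W_eq_bot (fun _ hv hk => eq_zero_of_mem_W_of_mem_Phi hk hv.1) inf_le_right

theorem Phi_sup_W {k l : ℤ} (h : k ≤ l) : W F k ⊔ (Phi F k ⊓ W F l) = W F l := by
  refine le_antisymm (sup_le (W_mono h) inf_le_right) fun v hv => ?_
  rw [← low_add_high k v]
  exact Submodule.add_mem_sup (low_mem_W k v) ⟨high_mem_Phi k v, high_mem_W hv⟩

theorem W_inf_Phi (k l : ℤ) : W F k ⊓ (Phi F k ⊓ W F l) = ⊥ :=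
  (Submodule.eq_bot_iff _).2 fun _ hv => eq_zero_of_mem_W_of_mem_Phi hv.1 hv.2.1

theorem isCompact_W [Finite F] (k : ℤ) : IsCompact (W F k : Set (SeqSpace F)) := by
  have h1 : IsClosed (W F k : Set (SeqSpace F)) :=
    AddSubgroup.isClosed_of_isOpen (W F k).toAddSubgroup (isOpen_W k)
  rcases le_total k 0 with h | h
  · exact isCompact_W_zero.of_isClosed_subset h1 (W_mono h)
  · have h2 : Finite (Phi F 0 ⊓ W F k : Submodule F (SeqSpace F)) := inferInstance
    have h3 : IsCompact ((Phi F 0 ⊓ W F k : Submodule F (SeqSpace F)) : Set (SeqSpace F)) :=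
      (Set.finite_coe_iff.1 h2).isCompact
    have h4 := isCompact_W_zero.add h3
    rwa [← Submodule.coe_sup, Phi_sup_W h] at h4

/-- A compact set of sequences is contained in some `W k`. -/
theorem exists_subset_W {K : Set (SeqSpace F)} (hK : IsCompact K) : ∃ k, K ⊆ W F k := by
  obtain ⟨k, hk⟩ := hK.elim_directed_cover (fun k : ℤ => (W F k : Set (SeqSpace F)))
    (fun k => isOpen_W k) (fun v _ => Set.mem_iUnion.2 (exists_mem_W v))
    (directed_of_isDirected_le fun _ _ h => W_mono h)
  exact ⟨k, hk⟩

/-- The image of `W l` is compact, hence bounded above. Together with the next lemma, which is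
continuity at zero, this makes every operator nearly triangular. -/
theorem exists_map_W_le [Finite F] (g : SeqSpace F ≃L[F] SeqSpace F) (l : ℤ) :
    ∃ m, ∀ v ∈ W F l, g v ∈ W F m := by
  obtain ⟨m, hm⟩ := exists_subset_W ((isCompact_W l).image g.continuous)
  exact ⟨m, fun v hv => hm ⟨v, hv, rfl⟩⟩

theorem exists_le_map_W (g : SeqSpace F ≃L[F] SeqSpace F) (l : ℤ) :
    ∃ k, ∀ v ∈ W F k, g v ∈ W F l := by
  have h : Filter.Tendsto g (𝓝 0) (𝓝 0) := by simpa using g.continuous.tendsto 0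
  obtain ⟨k, -, hk⟩ := (hasBasis_nhds_zero.tendsto_iff hasBasis_nhds_zero).1 h l trivial
  exact ⟨k, hk⟩

end Coordinates

/-! ### Counting dimensions by Haar measure. -/

section Volume

variable {F : Type*} [Field F] [Finite F]

/-- The Haar measure of a set of sequences. -/
def vol (S : Set (SeqSpace F)) : ENNReal := (Measure.addHaar : Measure (SeqSpace F)) S

theorem vol_W_pos (k : ℤ) : vol (W F k : Set (SeqSpace F)) ≠ 0 :=
  ((isOpen_W k).measure_pos _ ⟨0, zero_mem _⟩).ne'

theorem vol_W_ne_top (k : ℤ) : vol (W F k : Set (SeqSpace F)) ≠ ⊤ :=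
  (isCompact_W k).measure_ne_top

/-- The sum is a disjoint union of translates of `X`, indexed by the finite complement `Z`. -/
theorem vol_sup {X Z : Submodule F (SeqSpace F)} (hX : IsOpen (X : Set (SeqSpace F))) [Finite Z]
    (h : X ⊓ Z = ⊥) :
    vol ((X ⊔ Z : Submodule F (SeqSpace F)) : Set (SeqSpace F)) =
      Nat.card Z * vol (X : Set (SeqSpace F)) := by
  have h1 : ((X ⊔ Z : Submodule F (SeqSpace F)) : Set (SeqSpace F)) =
      ⋃ z : Z, (fun v => -z.1 + v) ⁻¹' (X : Set (SeqSpace F)) := by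
    ext v
    simp only [SetLike.mem_coe, Set.mem_iUnion, Set.mem_preimage, Submodule.mem_sup]
    constructor
    · rintro ⟨x, hx, z, hz, rfl⟩
      exact ⟨⟨z, hz⟩, by simpa using hx⟩
    · rintro ⟨z, hz⟩
      exact ⟨_, hz, z, z.2, by abel⟩
  have h2 : Pairwise (Function.onFun Disjoint fun z : Z => (fun v => -z.1 + v) ⁻¹' (X : Set (SeqSpace F))) := by
    intro z z' hzz
    refine Set.disjoint_left.2 fun v hv hv' => hzz ?_
    have h3 : z'.1 - z.1 ∈ X ⊓ Z :=
      ⟨by simpa [neg_add_eq_sub] using X.sub_mem hv hv', Z.sub_mem z'.2 z.2⟩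
    rw [h, Submodule.mem_bot, sub_eq_zero] at h3
    exact Subtype.ext h3.symm
  have := Fintype.ofFinite Z
  rw [h1, vol, measure_iUnion h2 fun z => (hX.preimage (by fun_prop)).measurableSet]
  simp only [measure_preimage_add, tsum_fintype, Finset.sum_const, Finset.card_univ,
    Nat.card_eq_fintype_card, nsmul_eq_mul, vol]

/-- This is how measure preservation becomes linear algebra: finite complements of open subspaces
can be compared, and then identified, by volume alone. -/
theorem card_eq_of_vol_eq {X Z X' Z' : Submodule F (SeqSpace F)} [Finite Z] [Finite Z']
    (hX : IsOpen (X : Set (SeqSpace F))) (hX' : IsOpen (X' : Set (SeqSpace F)))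
    (h : X ⊓ Z = ⊥) (h' : X' ⊓ Z' = ⊥)
    (hv : vol (X : Set (SeqSpace F)) = vol (X' : Set (SeqSpace F)))
    (h0 : vol (X : Set (SeqSpace F)) ≠ 0) (ht : vol (X : Set (SeqSpace F)) ≠ ⊤)
    (hs : vol ((X ⊔ Z : Submodule F (SeqSpace F)) : Set (SeqSpace F)) =
      vol ((X' ⊔ Z' : Submodule F (SeqSpace F)) : Set (SeqSpace F))) :
    Nat.card Z = Nat.card Z' := by
  rw [vol_sup hX h, vol_sup hX' h', ← hv, ENNReal.mul_left_inj h0 ht] at hs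
  exact_mod_cast hs

/-- Finite subspaces of the same cardinality are isomorphic. -/
theorem nonempty_linearEquiv_of_card_eq {Z Z' : Submodule F (SeqSpace F)} [Finite Z] [Finite Z']
    (h : Nat.card Z = Nat.card Z') : Nonempty (Z ≃ₗ[F] Z') := by
  refine FiniteDimensional.nonempty_linearEquiv_of_finrank_eq ?_
  rw [Module.natCard_eq_pow_finrank (K := F) (V := Z),
    Module.natCard_eq_pow_finrank (K := F) (V := Z')] at h
  exact Nat.pow_right_injective Finite.one_lt_card h

end Volume

end SeqSpace

/-! ### Operators given by a finite matrix block. -/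

section Block

variable {F : Type*} [Field F]

/-- The operator acting by a matrix on the coordinates `lo + 1, …, hi`. -/
def blockMap (α : Seg) (M : Matrix (Fin α.len) (Fin α.len) F) : SeqSpace F →ₗ[F] SeqSpace F :=
  LinearMap.id + ∑ i, (LinearMap.toSpanSingleton F _ (basisVec F (α.idx i))).comp
    (∑ k, (M i k - (1 : Matrix (Fin α.len) (Fin α.len) F) i k) • coord F (α.idx k))

theorem blockMap_idx (α : Seg) (M : Matrix (Fin α.len) (Fin α.len) F) (v : SeqSpace F)
    (i : Fin α.len) : (blockMap α M v) (α.idx i) = ∑ k, M i k * v (α.idx k) := by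
  simp [blockMap, LinearMap.toSpanSingleton_apply, basisVec_apply, α.idx_injective.eq_iff, sub_mul,
    Finset.sum_sub_distrib, Matrix.one_apply]

theorem blockMap_of_notMem (α : Seg) (M : Matrix (Fin α.len) (Fin α.len) F) (v : SeqSpace F)
    {j : ℤ} (hj : ∀ i, α.idx i ≠ j) : (blockMap α M v) j = v j := by
  simp [blockMap, LinearMap.toSpanSingleton_apply, basisVec_apply, fun i => (hj i).symm]

theorem blockMap_mul (α : Seg) (M N : Matrix (Fin α.len) (Fin α.len) F) (v : SeqSpace F) :
    blockMap α M (blockMap α N v) = blockMap α (M * N) v := by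
  ext j
  by_cases h : ∃ i, α.idx i = j
  · obtain ⟨i, rfl⟩ := h
    simp only [blockMap_idx, Matrix.mul_apply, Finset.mul_sum, Finset.sum_mul]
    rw [Finset.sum_comm]
    simp only [mul_assoc]
  · push Not at h
    simp only [blockMap_of_notMem α _ _ h]

theorem blockMap_one (α : Seg) (v : SeqSpace F) : blockMap α 1 v = v := by
  simp [blockMap]

theorem blockMap_of_mem_W (α : Seg) (M : Matrix (Fin α.len) (Fin α.len) F) {v : SeqSpace F}
    (hv : v ∈ W F α.lo) : blockMap α M v = v := by
  simp [blockMap, hv _ (α.idx_mem _).1]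

end Block

/-! ### Rigidity of measure-preserving operators, and the groups P̄_α and Q̄_α. -/

section Operators

variable {F : Type*} [Field F] [Finite F]

theorem mul_val_apply (g h : GLbar F) (v : SeqSpace F) : (g * h).1 v = g.1 (h.1 v) := rfl

theorem inv_val_apply_self (g : GLbar F) (v : SeqSpace F) : (g⁻¹).1 (g.1 v) = v :=
  g.1.symm_apply_apply v

theorem val_apply_inv_self (g : GLbar F) (v : SeqSpace F) : g.1 ((g⁻¹).1 v) = v :=
  g.1.apply_symm_apply v

theorem vol_preimage (g : GLbar F) {S : Set (SeqSpace F)} (hS : IsOpen S) :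
    vol (g.1 ⁻¹' S) = vol S := by
  conv_rhs => rw [vol, ← mem_GLbar.1 g.2]
  rw [Measure.map_apply g.1.continuous.measurable hS.measurableSet, vol]

theorem map_eq_preimage (g : GLbar F) (X : Submodule F (SeqSpace F)) :
    (X.map g.1.toLinearMap : Set (SeqSpace F)) = (g⁻¹).1 ⁻¹' X := by
  ext v
  constructor
  · rintro ⟨w, hw, rfl⟩
    change (g⁻¹).1 (g.1 w) ∈ X
    rwa [inv_val_apply_self]
  · intro hv
    exact ⟨_, hv, val_apply_inv_self g v⟩

theorem mem_map_val {g : GLbar F} {X : Submodule F (SeqSpace F)} {v : SeqSpace F} :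
    v ∈ X.map g.1.toLinearMap ↔ (g⁻¹).1 v ∈ X := by
  rw [← SetLike.mem_coe, map_eq_preimage]
  rfl

theorem isOpen_map_W (g : GLbar F) (k : ℤ) :
    IsOpen ((W F k).map g.1.toLinearMap : Set (SeqSpace F)) := by
  rw [map_eq_preimage]
  exact (isOpen_W k).preimage (g⁻¹).1.continuous

theorem vol_map_W (g : GLbar F) (k : ℤ) :
    vol ((W F k).map g.1.toLinearMap : Set (SeqSpace F)) = vol (W F k : Set (SeqSpace F)) := by
  rw [map_eq_preimage, vol_preimage _ (isOpen_W k)]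

/-- A linear automorphism which is the identity on some `W k` belongs to `GLbar`. -/
def GLbar.ofFix (f : SeqSpace F ≃ₗ[F] SeqSpace F) (k : ℤ) (hf : ∀ v ∈ W F k, f v = v) : GLbar F :=
  have hc : ∀ f : SeqSpace F ≃ₗ[F] SeqSpace F, (∀ v ∈ W F k, f v = v) → Continuous f :=
    fun f hf => by
      refine continuous_of_continuousAt_zero f.toLinearMap.toAddMonoidHom ?_
      rw [ContinuousAt, map_zero]
      refine (hasBasis_nhds_zero.tendsto_iff hasBasis_nhds_zero).2 fun l _ =>
        ⟨min k l, trivial, fun v hv => ?_⟩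
      change f v ∈ W F l
      rw [hf v (W_mono (min_le_left _ _) hv)]
      exact W_mono (min_le_right _ _) hv
  have hf' : ∀ v ∈ W F k, f.symm v = v := fun v hv => by
    rw [LinearEquiv.symm_apply_eq, hf v hv]
  let e : SeqSpace F ≃L[F] SeqSpace F :=
    { f with
      continuous_toFun := hc f hf
      continuous_invFun := hc f.symm hf' }
  ⟨e, by
    rw [mem_GLbar]
    have h4 := addEquivAddHaarChar_smul_map (Measure.addHaar : Measure (SeqSpace F))
      e.toContinuousAddEquiv
    set c := addEquivAddHaarChar e.toContinuousAddEquiv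
    have h5 : (c • Measure.map e (Measure.addHaar : Measure (SeqSpace F))) = Measure.addHaar := h4
    -- The scaling factor `c` of Haar measure can be read off from `W k`, which is its own preimage
    -- and has positive finite volume.
    have h6 : (Measure.map e (Measure.addHaar : Measure (SeqSpace F))) (W F k) =
        vol (W F k : Set (SeqSpace F)) := by
      rw [Measure.map_apply e.continuous.measurable (isOpen_W k).measurableSet, vol]
      congr 1
      ext v
      change f v ∈ W F k ↔ v ∈ W F k
      refine ⟨fun h => ?_, fun h => (hf v h).symm ▸ h⟩
      have := hf' _ h
      rw [f.symm_apply_apply] at this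
      rwa [this]
    have h7 : (c : ENNReal) * vol (W F k : Set (SeqSpace F)) = vol (W F k : Set (SeqSpace F)) := by
      conv_rhs => rw [vol, ← h5]
      rw [Measure.smul_apply, h6]
      rfl
    have h8 : c = 1 := by
      have := (ENNReal.mul_eq_right (vol_W_pos k) (vol_W_ne_top k)).1 h7
      exact_mod_cast this
    rwa [h8, one_smul] at h5⟩

/-- An element of `GLbar` mapping `W k` into `W k` maps it onto `W k`. -/
theorem inv_mem_W_of_forall {g : GLbar F} {k : ℤ} (h : ∀ v ∈ W F k, g.1 v ∈ W F k)
    {v : SeqSpace F} (hv : v ∈ W F k) : (g⁻¹).1 v ∈ W F k := by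
  let X := (W F k).map g.1.toLinearMap
  have hX : X ≤ W F k := by
    rintro _ ⟨w, hw, rfl⟩
    exact h w hw
  obtain ⟨C, hC⟩ := Submodule.exists_isCompl X
  let Z := C ⊓ W F k
  have h1 : X ⊓ Z = ⊥ := by
    rw [← inf_assoc, hC.inf_eq_bot, bot_inf_eq]
  have h2 : X ⊔ Z = W F k := by
    rw [← sup_inf_assoc_of_le C hX, hC.sup_eq_top, top_inf_eq]
  obtain ⟨m, hm⟩ := exists_le_map_W (g⁻¹).1 k
  have : Finite Z := finite_of_inf_W_eq_bot (k := m) (l := k) (fun v hv hv' => by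
    have : v ∈ X ⊓ Z := ⟨mem_map_val.2 (hm v hv'), hv⟩
    rwa [h1] at this) inf_le_right
  -- The image `X` has the volume of `W k` and `W k = X ⊔ Z`, so `Z` is no larger than the trivial
  -- complement of `W k` in itself.
  have h3 : Nat.card Z = Nat.card (⊥ : Submodule F (SeqSpace F)) :=
    card_eq_of_vol_eq (isOpen_map_W g k) (isOpen_W k) h1 (inf_bot_eq _)
      (vol_map_W g k) (by rw [vol_map_W]; exact vol_W_pos k)
      (by rw [vol_map_W]; exact vol_W_ne_top k) (by rw [h2, sup_bot_eq])
  have h4 : Z = ⊥ := by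
    rw [Nat.card_unique (α := (⊥ : Submodule F (SeqSpace F))), Nat.card_eq_one_iff_unique] at h3
    exact (Submodule.subsingleton_iff_eq_bot).1 h3.1
  rw [h4, sup_bot_eq] at h2
  rw [← h2] at hv
  exact mem_map_val.1 hv

theorem map_W_eq_of_forall {g : GLbar F} {k : ℤ} (h : ∀ v ∈ W F k, g.1 v ∈ W F k) :
    (W F k).map g.1.toLinearMap = W F k := by
  refine le_antisymm ?_ fun v hv => mem_map_val.2 (inv_mem_W_of_forall h hv)
  rintro _ ⟨w, hw, rfl⟩
  exact h w hw

/-- If `g ∈ GLbar` maps `W a` into `W b`, then `a ≤ b`. -/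
theorem le_of_map_W_le {g : GLbar F} {a b : ℤ} (h : ∀ v ∈ W F a, g.1 v ∈ W F b) : a ≤ b := by
  by_contra hab
  push Not at hab
  -- If `b < a`, then `g` maps `W a` into itself, hence onto itself; the basis vector with number
  -- `a` would then lie in `W b`.
  have h1 := inv_mem_W_of_forall (fun v hv => W_mono hab.le (h v hv)) (basisVec_mem_W.2 le_rfl)
  have h2 := h _ h1
  rw [val_apply_inv_self, basisVec_mem_W] at h2
  omega

theorem mem_Pbar_of_forall {α : Seg} {g : GLbar F} (h1 : ∀ v ∈ W F α.lo, g.1 v ∈ W F α.lo)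
    (h2 : ∀ v ∈ W F α.hi, g.1 v ∈ W F α.hi) : g ∈ Pbar F α :=
  ⟨map_W_eq_of_forall h1, map_W_eq_of_forall h2⟩

/-- `Q̄_α` consists of the operators which are the identity on `W α.hi` modulo `W α.lo`. -/
theorem mem_Qbar_iff {α : Seg} {g : GLbar F} :
    g ∈ Qbar F α ↔ ∀ v ∈ W F α.hi, g.1 v - v ∈ W F α.lo := by
  constructor
  · rintro ⟨p, hp, rfl⟩ v hv
    change p.1.1 v - v ∈ W F α.lo
    have h0 : midBlock α p.1 = 1 := congrArg Units.val (show blockHom F α p = 1 from hp)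
    have h1 : ∀ k, p.1.1 (basisVec F (α.idx k)) - basisVec F (α.idx k) ∈ W F α.lo := fun k j hj => by
      rcases le_or_gt j α.hi with hj' | hj'
      · obtain ⟨i, rfl⟩ := α.exists_idx hj hj'
        have h2 : (p.1.1 (basisVec F (α.idx k))) (α.idx i) = _ := congrFun (congrFun h0 i) k
        rw [SeqSpace.sub_apply, h2, basisVec_apply, Matrix.one_apply]
        simp [α.idx_injective.eq_iff]
      · have hb : basisVec F (α.idx k) ∈ W F α.hi := basisVec_mem_W.2 (α.idx_mem k).2
        exact Submodule.sub_mem _ (Pbar_hi p.2 hb) hb j hj'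
    have h3 := sub_sum_mem α hv
    have h4 := Pbar_lo p.2 h3
    have h5 : ∑ k, v (α.idx k) • (p.1.1 (basisVec F (α.idx k)) - basisVec F (α.idx k)) ∈ W F α.lo :=
      Submodule.sum_mem _ fun k _ => Submodule.smul_mem _ _ (h1 k)
    have h6 := Submodule.add_mem _ (Submodule.sub_mem _ h4 h3) h5
    convert h6 using 1
    simp only [map_sub, map_sum, map_smul, smul_sub, Finset.sum_sub_distrib]
    abel
  · intro h
    have hP : g ∈ Pbar F α := mem_Pbar_of_forall
      (fun v hv => by simpa using Submodule.add_mem _ (h v (W_mono α.le hv)) hv)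
      (fun v hv => by simpa using Submodule.add_mem _ (W_mono α.le (h v hv)) hv)
    refine ⟨⟨g, hP⟩, Units.ext ?_, rfl⟩
    ext i j
    have h1 := h _ (basisVec_mem_W.2 (α.idx_mem j).2) (α.idx i) (α.idx_mem i).1
    rw [SeqSpace.sub_apply, sub_eq_zero, basisVec_apply] at h1
    change (g.1 (basisVec F (α.idx j))) (α.idx i) = _
    rw [h1, Units.val_one, Matrix.one_apply]
    simp [α.idx_injective.eq_iff]

theorem Qbar_le_Pbar (α : Seg) : Qbar F α ≤ Pbar F α := by
  rintro _ ⟨p, -, rfl⟩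
  exact p.2

theorem blockHom_eq_one_iff {α : Seg} {p : Pbar F α} : blockHom F α p = 1 ↔ p.1 ∈ Qbar F α := by
  refine ⟨fun h => ⟨p, h, rfl⟩, ?_⟩
  rintro ⟨q, hq, h⟩
  obtain rfl : q = p := Subtype.ext h
  exact hq

/-- Through this, irreducibility of τ passes to its inflation to P̄_α. -/
theorem blockHom_surjective (α : Seg) : Function.Surjective (blockHom F α) := by
  intro M
  let f : SeqSpace F ≃ₗ[F] SeqSpace F := LinearEquiv.ofLinearMap (blockMap α M.1) (blockMap α (M⁻¹).1)
    (LinearMap.ext fun v => by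
      change blockMap α _ (blockMap α _ v) = v
      rw [blockMap_mul, ← Units.val_mul, mul_inv_cancel, Units.val_one, blockMap_one])
    (LinearMap.ext fun v => by
      change blockMap α _ (blockMap α _ v) = v
      rw [blockMap_mul, ← Units.val_mul, inv_mul_cancel, Units.val_one, blockMap_one])
  have hf : ∀ v ∈ W F α.lo, f v = v := fun v hv => blockMap_of_mem_W α M.1 hv
  let g : GLbar F := GLbar.ofFix f α.lo hf
  have hg : g ∈ Pbar F α := mem_Pbar_of_forall (fun v hv => (hf v hv).symm ▸ hv) fun v hv j hj => by
    have h1 : ∀ i, α.idx i ≠ j := fun i => ((α.idx_mem i).2.trans_lt hj).ne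
    exact (blockMap_of_notMem α M.1 v h1).trans (hv j hj)
  refine ⟨⟨g, hg⟩, Units.ext ?_⟩
  ext i j
  change (blockMap α M.1 (basisVec F (α.idx j))) (α.idx i) = _
  rw [blockMap_idx]
  simp [basisVec_apply, α.idx_injective.eq_iff]

end Operators

/-! ### Shears and block interchanges. -/

section Elementary

variable {F : Type*} [Field F] [Finite F]

/-- The operator `u ↦ u + φ(u) v`. -/
def shear (φ : SeqSpace F →ₗ[F] F) (v : SeqSpace F) (k : ℤ) (hφ : ∀ u ∈ W F k, φ u = 0)
    (h : 1 + φ v ≠ 0) : GLbar F :=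
  GLbar.ofFix
    -- The inverse is the rank-one (Sherman–Morrison) formula.
    (LinearEquiv.ofLinearMap (LinearMap.id + (LinearMap.toSpanSingleton F _ v).comp φ)
      (LinearMap.id - (LinearMap.toSpanSingleton F _ v).comp ((1 + φ v)⁻¹ • φ))
      (LinearMap.ext fun u => by
        have h1 : φ (u - ((1 + φ v)⁻¹ * φ u) • v) = (1 + φ v)⁻¹ * φ u := by
          rw [map_sub, map_smul, smul_eq_mul]
          field_simp
          ring
        change u - ((1 + φ v)⁻¹ * φ u) • v + φ (u - ((1 + φ v)⁻¹ * φ u) • v) • v = u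
        rw [h1, sub_add_cancel])
      (LinearMap.ext fun u => by
        have h1 : (1 + φ v)⁻¹ * φ (u + φ u • v) = φ u := by
          rw [map_add, map_smul, smul_eq_mul]
          field_simp
        change u + φ u • v - ((1 + φ v)⁻¹ * φ (u + φ u • v)) • v = u
        rw [h1, add_sub_cancel_right]))
    k fun u hu => by simp [hφ u hu]

theorem shear_apply (φ : SeqSpace F →ₗ[F] F) (v : SeqSpace F) (k : ℤ) (hφ : ∀ u ∈ W F k, φ u = 0)
    (h : 1 + φ v ≠ 0) (u : SeqSpace F) : (shear φ v k hφ h).1 u = u + φ u • v := rfl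

/-- The involution of `ℤ` interchanging the segments `(a, b]` and `(a + s, b + s]`. -/
def shiftIndex (a b s j : ℤ) : ℤ :=
  if a < j ∧ j ≤ b then j + s else if a + s < j ∧ j ≤ b + s then j - s else j

/-- The condition `b ≤ a + s` makes the two segments disjoint. -/
theorem shiftIndex_shiftIndex {a b s : ℤ} (h : b ≤ a + s) (j : ℤ) :
    shiftIndex a b s (shiftIndex a b s j) = j := by
  unfold shiftIndex
  split_ifs <;> omega

theorem shiftIndex_of_le {a b s j : ℤ} (hs : 0 ≤ s) (hj : j ≤ a) : shiftIndex a b s j = j := by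
  unfold shiftIndex
  split_ifs <;> omega

theorem shiftIndex_of_lt {a b s j : ℤ} (hs : 0 ≤ s) (hj : b + s < j) :
    shiftIndex a b s j = j := by
  unfold shiftIndex
  split_ifs <;> omega

theorem lt_shiftIndex {a b s j : ℤ} (hs : 0 ≤ s) (hj : a < j) : a < shiftIndex a b s j := by
  unfold shiftIndex
  split_ifs <;> omega

theorem apply_shiftIndex_of_mem_W {F : Type*} [Field F] {a b s : ℤ} (hs : 0 ≤ s) {v : SeqSpace F}
    (hv : v ∈ W F a) (j : ℤ) : v (shiftIndex a b s j) = v j := by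
  rcases le_or_gt j a with hj | hj
  · rw [shiftIndex_of_le hs hj]
  · rw [hv j hj, hv _ (lt_shiftIndex hs hj)]

/-- The operator interchanging the blocks of coordinates `(a, b]` and `(a + s, b + s]`. -/
def shiftSwap (F : Type*) [Field F] [Finite F] (a b s : ℤ) (h : b ≤ a + s) (hs : 0 ≤ s) : GLbar F :=
  GLbar.ofFix
    (LinearEquiv.ofInvolutive
      { toFun := fun v => ⟨fun j => v (shiftIndex a b s j), by
          obtain ⟨N, hN⟩ := v.2
          refine ⟨max N (b + s), fun j hj => hN _ ?_⟩
          rw [max_lt_iff] at hj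
          unfold shiftIndex
          split_ifs <;> omega⟩
        map_add' := fun _ _ => rfl
        map_smul' := fun _ _ => rfl }
      fun v => by
        ext j
        exact congrArg v.1 (shiftIndex_shiftIndex h j))
    a fun _ hv => SeqSpace.ext (apply_shiftIndex_of_mem_W hs hv)

theorem shiftSwap_inv (a b s : ℤ) (h : b ≤ a + s) (hs : 0 ≤ s) :
    (shiftSwap F a b s h hs)⁻¹ = shiftSwap F a b s h hs := by
  rw [inv_eq_iff_mul_eq_one]
  ext v j
  change v (shiftIndex a b s (shiftIndex a b s j)) = v j
  rw [shiftIndex_shiftIndex h]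

end Elementary

/-! ### The topology of the group and approximation of its elements. -/

section GroupTopology

variable {F : Type*} [Field F] [Finite F]

/-- The condition says that g⁻¹h − 1 maps the compact set `W α.hi` into the open set `W α.lo`, which
is open in the compact-open topology. -/
theorem isOpen_setOf_inv_mul_mem_Qbar (α : Seg) (g : GLbar F) :
    IsOpen {h : GLbar F | g⁻¹ * h ∈ Qbar F α} := by
  let T : GLbar F → C(SeqSpace F, SeqSpace F) := fun g => ⟨g.1, g.1.continuous⟩
  have hT : Continuous T := continuous_induced_dom
  have h1 : Continuous fun h => (T g⁻¹).comp (T h) - ContinuousMap.id _ :=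
    ((ContinuousMap.continuous_postcomp _).comp hT).sub continuous_const
  have h2 := (ContinuousMap.isOpen_setOfPred_mapsTo (isCompact_W (F := F) α.hi)
    (isOpen_W α.lo)).preimage h1
  convert h2 using 1
  ext h
  exact mem_Qbar_iff

/-- Each compact set lies in some `W l` and the `W k` are a neighbourhood basis at zero, so the
choices k = −n, l = n give a sequence converging to `r` in the group topology. -/
theorem mem_of_isClosed_of_approx {C : Set (GLbar F)} (hC : IsClosed C) {r : GLbar F}
    (h : ∀ k l : ℤ, ∃ s ∈ C, ∀ v ∈ W F l, s.1 v - r.1 v ∈ W F k) : r ∈ C := by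
  choose s hs hsr using fun n : ℕ => h (-n) n
  refine hC.mem_of_tendsto (f := s) (b := Filter.atTop) ?_ (Filter.Eventually.of_forall hs)
  rw [nhds_induced, Filter.tendsto_comap_iff, ContinuousMap.tendsto_nhds_compactOpen]
  intro K hK U hU hKU
  obtain ⟨l, hl⟩ := exists_subset_W hK
  obtain ⟨V, hV, hVU⟩ := compact_open_separated_add_right (hK.image r.1.continuous) hU
    (Set.image_subset_iff.2 hKU)
  obtain ⟨k, -, hk⟩ := hasBasis_nhds_zero.mem_iff.1 hV
  filter_upwards [Filter.eventually_ge_atTop (l.toNat + (-k).toNat)] with n hn v hv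
  have h1 := W_mono (show -(n : ℤ) ≤ k by omega) (hsr n v (W_mono (by omega) (hl hv)))
  have h2 := hVU (Set.add_mem_add ⟨v, hv, rfl⟩ (hk h1))
  rwa [add_sub_cancel] at h2

/-- An element of `GLbar` is approximated, on each `W l`, by elements which coincide with it on
`W l` and fix all basis vectors with sufficiently large numbers. -/
theorem exists_eq_on_W_fix_Phi (r : GLbar F) (l : ℤ) :
    ∃ s : GLbar F, (∀ v ∈ W F l, s.1 v = r.1 v) ∧ ∃ J, ∀ v ∈ Phi F J, s.1 v = v := by
  obtain ⟨J, hlJ, hJ⟩ : ∃ J, l ≤ J ∧ ∀ v ∈ W F l, r.1 v ∈ W F J := by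
    obtain ⟨J, hJ⟩ := exists_map_W_le r.1 l
    exact ⟨max l J, le_max_left _ _, fun v hv => W_mono (le_max_right _ _) (hJ v hv)⟩
  let X := (W F l).map r.1.toLinearMap
  have hX : X ≤ W F J := by
    rintro _ ⟨w, hw, rfl⟩
    exact hJ w hw
  obtain ⟨C, hC⟩ := Submodule.exists_isCompl X
  let Z := C ⊓ W F J
  have h1 : X ⊓ Z = ⊥ := by
    rw [← inf_assoc, hC.inf_eq_bot, bot_inf_eq]
  have h2 : X ⊔ Z = W F J := by
    rw [← sup_inf_assoc_of_le C hX, hC.sup_eq_top, top_inf_eq]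
  obtain ⟨k, hk⟩ := exists_le_map_W (r⁻¹).1 l
  have : Finite Z := finite_of_inf_W_eq_bot (k := k) (l := J) (fun v hv hv' => by
    have : v ∈ X ⊓ Z := ⟨mem_map_val.2 (hk v hv'), hv⟩
    rwa [h1] at this) inf_le_right
  -- Both spaces complement a subspace of volume vol(`W l`) in `W J`, so θ exists. It lets the map
  -- return to the identity above `J`.
  obtain ⟨θ⟩ := nonempty_linearEquiv_of_card_eq (card_eq_of_vol_eq (Z := Phi F l ⊓ W F J) (Z' := Z)
    (isOpen_W l) (isOpen_map_W r l) (W_inf_Phi l J) h1 (vol_map_W r l).symm (vol_W_pos l)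
    (vol_W_ne_top l) (by rw [h2, Phi_sup_W hlJ]))
  have hmid : ∀ u, low F J (high F l u) ∈ Phi F l ⊓ W F J := fun u =>
    ⟨fun j hj => by simp [hj], low_mem_W _ _⟩
  let f : SeqSpace F →ₗ[F] SeqSpace F := r.1.toLinearMap.comp (low F l) +
    (Z.subtype.comp (θ.toLinearMap.comp (((low F J).comp (high F l)).codRestrict _ hmid))) + high F J
  have hf : ∀ u, f u = r.1 (low F l u) + (θ ⟨low F J (high F l u), hmid u⟩ : SeqSpace F) +
    high F J u := fun u => rfl
  have hdec : ∀ u, u = low F l u + low F J (high F l u) + high F J u := fun u => by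
    ext j
    simp only [SeqSpace.add_apply, low_apply, high_apply]
    split_ifs <;> first | omega | simp
  have hinj : Function.Injective f := by
    refine (injective_iff_map_eq_zero f).2 fun u hu => ?_
    rw [hf] at hu
    have hθ := (θ ⟨low F J (high F l u), hmid u⟩).2
    have h4 : r.1 (low F l u) + (θ ⟨low F J (high F l u), hmid u⟩ : SeqSpace F) ∈ W F J :=
      Submodule.add_mem _ (hJ _ (low_mem_W _ _)) hθ.2
    have h5 : high F J u = 0 := eq_zero_of_mem_W_of_mem_Phi (k := J)
      (by rw [← neg_eq_of_add_eq_zero_right hu]; exact Submodule.neg_mem _ h4) (high_mem_Phi _ _)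
    rw [h5, add_zero] at hu
    have h6 : r.1 (low F l u) ∈ X ⊓ Z :=
      ⟨⟨_, low_mem_W _ _, rfl⟩, by rw [eq_neg_of_add_eq_zero_left hu]; exact Z.neg_mem hθ⟩
    rw [h1, Submodule.mem_bot] at h6
    rw [h6, zero_add, ZeroMemClass.coe_eq_zero, LinearEquiv.map_eq_zero_iff] at hu
    rw [hdec u, h5, (LinearEquiv.map_eq_zero_iff r.1.toLinearEquiv).1 h6,
      show low F J (high F l u) = 0 from congrArg Subtype.val hu]
    simp
  have hW : ∀ u ∈ W F l, f u = r.1 u := fun u hu => by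
    rw [hf, low_of_mem_W hu, high_of_mem_W (W_mono hlJ hu)]
    simp [high_of_mem_W hu]
  have hPhi : ∀ u ∈ Phi F J, f u = u := fun u hu => by
    have h4 : low F J (high F l u) = 0 := by
      rw [high_of_mem_Phi (Phi_anti hlJ hu), low_of_mem_Phi hu]
    rw [hf, low_of_mem_Phi (Phi_anti hlJ hu), high_of_mem_Phi hu]
    simp [h4]
  have hsurj : Function.Surjective f := by
    intro v
    have h4 : low F J v ∈ X ⊔ Z := h2.symm ▸ low_mem_W J v
    obtain ⟨_, ⟨w, hw, rfl⟩, z, hz, hwz⟩ := Submodule.mem_sup.1 h4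
    refine ⟨w + (θ.symm ⟨z, hz⟩ : SeqSpace F) + high F J v, ?_⟩
    have h5 : f (θ.symm ⟨z, hz⟩ : SeqSpace F) = z := by
      have h6 := (θ.symm ⟨z, hz⟩).2
      have h7 : (⟨_, hmid (θ.symm ⟨z, hz⟩ : SeqSpace F)⟩ : ↥(Phi F l ⊓ W F J)) =
          θ.symm ⟨z, hz⟩ :=
        Subtype.ext (by
          change low F J (high F l _) = _
          rw [high_of_mem_Phi h6.1, low_of_mem_W h6.2])
      rw [hf, h7, low_of_mem_Phi h6.1, high_of_mem_W h6.2]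
      simp
    rw [map_add, map_add, hW w hw, h5, hPhi _ (high_mem_Phi _ _)]
    conv_rhs => rw [← low_add_high J v, ← hwz]
    rfl
  let e := LinearEquiv.ofBijective f ⟨hinj, hsurj⟩
  -- `f` is not the identity on any evident `W k`, but r⁻¹f is the identity on `W l`; hence `f`
  -- preserves the measure.
  let s : GLbar F := r * GLbar.ofFix (e.trans r.1.symm.toLinearEquiv) l fun v hv => by
    change r.1.symm (f v) = v
    rw [hW v hv, ContinuousLinearEquiv.symm_apply_apply]
  have hs : ∀ v, s.1 v = f v := fun v => r.1.apply_symm_apply (f v)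
  exact ⟨s, fun v hv => (hs v).trans (hW v hv), J, fun v hv => (hs v).trans (hPhi v hv)⟩

/-- An element of `GLbar` is approximated, modulo each `W k`, by elements which are congruent to it
modulo `W k` and do not change coordinates with sufficiently small numbers. -/
theorem exists_sub_mem_W_fix_coord (r : GLbar F) (k : ℤ) :
    ∃ s : GLbar F, (∀ v, s.1 v - r.1 v ∈ W F k) ∧ ∃ J, ∀ v, s.1 v - v ∈ Phi F J := by
  obtain ⟨m, hmk, hm⟩ : ∃ m, m ≤ k ∧ ∀ v ∈ W F m, r.1 v ∈ W F k := by
    obtain ⟨m, hm⟩ := exists_le_map_W r.1 k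
    exact ⟨min k m, min_le_left _ _, fun v hv => hm v (W_mono (min_le_right _ _) hv)⟩
  let Y := (W F k).map (r⁻¹).1.toLinearMap
  have hY : ∀ v, v ∈ Y ↔ r.1 v ∈ W F k := fun v => by
    rw [mem_map_val, inv_inv]
  let N := Phi F m ⊓ Y
  have h1 : W F m ⊓ N = ⊥ :=
    (Submodule.eq_bot_iff _).2 fun _ hv => eq_zero_of_mem_W_of_mem_Phi hv.1 hv.2.1
  have h2 : W F m ⊔ N = Y := by
    have hmY : W F m ≤ Y := fun v hv => (hY v).2 (hm v hv)
    refine le_antisymm (sup_le hmY inf_le_right) fun v hv => ?_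
    rw [← low_add_high m v]
    refine Submodule.add_mem_sup (low_mem_W m v) ⟨high_mem_Phi m v, ?_⟩
    rw [← add_sub_cancel_left (low F m v) (high F m v), low_add_high]
    exact Y.sub_mem hv (hmY (low_mem_W m v))
  obtain ⟨l, hl⟩ := exists_map_W_le (r⁻¹).1 k
  have hN : Finite N := finite_of_inf_W_eq_bot (k := m) (l := l)
    (fun v hv hv' => eq_zero_of_mem_W_of_mem_Phi hv' hv.1) fun v hv => by
      have := hl _ ((hY v).1 hv.2)
      rwa [inv_val_apply_self] at this
  -- Setting the part of `r` below level `k` aside leaves the kernel `N`, a complement of `W m` in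
  -- r⁻¹`W k`. By volume, `N` has the size of the coordinates (m, k] not yet reached, and θ fills
  -- them.
  obtain ⟨θ⟩ := nonempty_linearEquiv_of_card_eq (card_eq_of_vol_eq (Z := N) (Z' := Phi F m ⊓ W F k)
    (isOpen_W m) (isOpen_W m) h1 (W_inf_Phi m k) rfl (vol_W_pos m)
    (vol_W_ne_top m) (by rw [h2, Phi_sup_W hmk, vol_map_W]))
  obtain ⟨π, hπ⟩ := N.subtype.exists_leftInverse_of_injective
    (LinearMap.ker_eq_bot.2 N.injective_subtype)
  have hπ' : ∀ v : N, π v = v := fun v => LinearMap.congr_fun hπ v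
  let f : SeqSpace F →ₗ[F] SeqSpace F := low F m + (high F k).comp (r.1.toLinearMap.comp (high F m)) +
    (Submodule.subtype _).comp (θ.toLinearMap.comp (π.comp (high F m)))
  have hf : ∀ u, f u = low F m u + high F k (r.1 (high F m u)) + (θ (π (high F m u)) : SeqSpace F) :=
    fun u => rfl
  have hW : ∀ u ∈ W F m, f u = u := fun u hu => by
    rw [hf, low_of_mem_W hu, high_of_mem_W hu]
    simp
  have hsubPhi : ∀ u, f u - u ∈ Phi F m := fun u => by
    have h4 : f u - u = high F k (r.1 (high F m u)) + (θ (π (high F m u)) : SeqSpace F) -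
        high F m u := by
      rw [hf, eq_sub_of_add_eq (low_add_high m u)]
      abel
    rw [h4]
    exact Submodule.sub_mem _ (Submodule.add_mem _ (Phi_anti hmk (high_mem_Phi _ _))
      (θ (π (high F m u))).2.1) (high_mem_Phi _ _)
  have hinj : Function.Injective f := by
    refine (injective_iff_map_eq_zero f).2 fun u hu => ?_
    have hu1 : u ∈ Phi F m := by
      have := hsubPhi u
      rwa [hu, zero_sub, Submodule.neg_mem_iff] at this
    rw [hf, low_of_mem_Phi hu1, high_of_mem_Phi hu1, zero_add] at hu
    have h5 : high F k (r.1 u) = 0 := eq_zero_of_mem_W_of_mem_Phi (k := k)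
      (by rw [eq_neg_of_add_eq_zero_left hu]; exact Submodule.neg_mem _ (θ (π u)).2.2)
      (high_mem_Phi _ _)
    have h6 : u ∈ N := ⟨hu1, (hY u).2 (by
      rw [← low_add_high k (r.1 u), h5, add_zero]
      exact low_mem_W _ _)⟩
    rw [h5, zero_add, ZeroMemClass.coe_eq_zero, LinearEquiv.map_eq_zero_iff] at hu
    have h7 := hπ' ⟨u, h6⟩
    exact congrArg Subtype.val (h7.symm.trans hu)
  have hsurj : Function.Surjective f := by
    have h4 : ∀ n : N, f n = (θ n : SeqSpace F) := fun n => by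
      rw [hf, low_of_mem_Phi n.2.1, high_of_mem_Phi n.2.1, hπ', high_of_mem_W ((hY _).1 n.2.2)]
      simp
    have h5 : ∀ v ∈ Phi F k, ∃ u, f u = v := fun v hv => by
      let u := high F m ((r⁻¹).1 v)
      have hu : u ∈ Phi F m := high_mem_Phi _ _
      have h6 : high F k (r.1 u) = v := by
        have h7 : u = (r⁻¹).1 v - low F m ((r⁻¹).1 v) := rfl
        rw [h7, map_sub, val_apply_inv_self, map_sub, high_of_mem_Phi hv,
          high_of_mem_W (hm _ (low_mem_W _ _)), sub_zero]
      refine ⟨u - (π u : SeqSpace F), ?_⟩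
      rw [map_sub, h4, hf, low_of_mem_Phi hu, high_of_mem_Phi hu, h6]
      simp
    intro v
    obtain ⟨u, hu⟩ := h5 (high F k v) (high_mem_Phi _ _)
    let w := high F m (low F k v)
    have hw : w ∈ Phi F m ⊓ W F k := ⟨high_mem_Phi _ _, high_mem_W (low_mem_W _ _)⟩
    refine ⟨low F m (low F k v) + (θ.symm ⟨w, hw⟩ : SeqSpace F) + u, ?_⟩
    rw [map_add, map_add, hW _ (low_mem_W _ _), h4, hu, LinearEquiv.apply_symm_apply,
      low_add_high, low_add_high]
  let s : GLbar F := GLbar.ofFix (LinearEquiv.ofBijective f ⟨hinj, hsurj⟩) m hW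
  refine ⟨s, fun v => ?_, m, hsubPhi⟩
  change f v - r.1 v ∈ W F k
  have h4 : r.1 v = r.1 (low F m v) + (low F k (r.1 (high F m v)) + high F k (r.1 (high F m v))) := by
    rw [low_add_high, ← map_add, low_add_high]
  rw [hf, h4]
  have h5 : low F m v + (θ (π (high F m v)) : SeqSpace F) - r.1 (low F m v) -
      low F k (r.1 (high F m v)) ∈ W F k :=
    Submodule.sub_mem _ (Submodule.sub_mem _ (Submodule.add_mem _ (W_mono hmk (low_mem_W _ _))
      (θ (π (high F m v))).2.2) (hm _ (low_mem_W _ _))) (low_mem_W _ _)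
  convert h5 using 1
  abel

end GroupTopology

/-! ### Weak limit points of orbits. -/

section WeakLimits

variable {G : Type*} [Group G] {H : Type*} [NormedAddCommGroup H] [InnerProductSpace ℂ H]

theorem map_mul_rep_apply (ρ : G →* (H ≃ₗᵢ[ℂ] H)) (g h : G) (v : H) :
    ρ (g * h) v = ρ g (ρ h v) := by
  rw [map_mul]
  rfl

theorem rep_apply_inv_self (ρ : G →* (H ≃ₗᵢ[ℂ] H)) (g : G) (v : H) : ρ g (ρ g⁻¹ v) = v := by
  rw [← map_mul_rep_apply, mul_inv_cancel, map_one]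
  rfl

theorem inner_rep_left (ρ : G →* (H ≃ₗᵢ[ℂ] H)) (g : G) (v w : H) :
    inner ℂ (ρ g v) w = inner ℂ v (ρ g⁻¹ w) := by
  rw [← LinearIsometryEquiv.inner_map_map (ρ g) v, rep_apply_inv_self]

theorem rep_apply_eq_self_of_conj {ρ : G →* (H ≃ₗᵢ[ℂ] H)} {K : Subgroup G} {h : H}
    (hh : h ∈ fixedVectors ρ K) {g t : G} (ht : g⁻¹ * t * g ∈ K) : ρ t (ρ g h) = ρ g h := by
  rw [← map_mul_rep_apply, show t * g = g * (g⁻¹ * t * g) by group, map_mul_rep_apply, hh _ ht]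

/-- A weak limit point of the sequence `ρ (q n) x` has the same inner products with vectors fixed by
all `q n`, and is fixed by all `r` such that `(q n)⁻¹ * r * q n` fixes `x` for all large `n`. -/
theorem exists_weak_limit [CompleteSpace H] (ρ : G →* (H ≃ₗᵢ[ℂ] H)) (q : ℕ → G) (x : H) :
    ∃ x' : H, (∀ y, (∀ n, ρ (q n) y = y) → inner ℂ x' y = inner ℂ x y) ∧
      ∀ r, (∀ᶠ n in Filter.atTop, ρ ((q n)⁻¹ * r * q n) x = x) → ρ r x' = x' := by
  let f : ℕ → WeakDual ℂ H := fun n =>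
    StrongDual.toWeakDual (InnerProductSpace.toDual ℂ H (ρ (q n) x))
  -- Banach–Alaoglu along a non-principal ultrafilter: no separability of `H` is needed, and
  -- properties holding for large n pass to the limit.
  obtain ⟨a, -, ha⟩ := (WeakDual.isCompact_closedBall (0 : StrongDual ℂ H) ‖x‖).ultrafilter_le_nhds
    ((Filter.hyperfilter ℕ).map f) (Filter.le_principal_iff.2 (Filter.mem_map.2
      (Filter.Eventually.of_forall fun n => by
        change InnerProductSpace.toDual ℂ H (ρ (q n) x) ∈ Metric.closedBall 0 ‖x‖
        simp)))
  let x' := (InnerProductSpace.toDual ℂ H).symm (WeakDual.toStrongDual a)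
  have hx' : ∀ w, Filter.Tendsto (fun n => inner ℂ (ρ (q n) x) w) (Filter.hyperfilter ℕ)
      (𝓝 (inner ℂ x' w)) := fun w => by
    have h1 : Filter.Tendsto (fun n => f n w) (Filter.hyperfilter ℕ) (𝓝 (a w)) :=
      ((WeakDual.eval_continuous w).tendsto a).comp ha
    have h2 : inner ℂ x' w = a w := InnerProductSpace.toDual_symm_apply
    rw [h2]
    exact h1
  refine ⟨x', fun y hy => ?_, fun r hr => ?_⟩
  · refine tendsto_nhds_unique (hx' y) (tendsto_const_nhds.congr fun n => ?_)
    conv_rhs => rw [← hy n]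
    rw [LinearIsometryEquiv.inner_map_map]
  · refine ext_inner_right ℂ fun w => ?_
    rw [inner_rep_left]
    refine tendsto_nhds_unique ((hx' (ρ r⁻¹ w)).congr' ?_) (hx' w)
    refine Filter.Eventually.filter_mono Nat.hyperfilter_le_atTop (hr.mono fun n hn => ?_)
    beta_reduce
    rw [← inner_rep_left, ← map_mul_rep_apply, show r * q n = q n * ((q n)⁻¹ * r * q n) by group,
      map_mul_rep_apply, hn]

end WeakLimits

/-! ### Orthogonality of the translates of H_α. -/

section Orthogonality

variable {F : Type*} [Field F] [Finite F] {H : Type*} [NormedAddCommGroup H]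
  [InnerProductSpace ℂ H] {ρ : GLbar F →* (H ≃ₗᵢ[ℂ] H)}

theorem isClosed_stabilizer (hρ : IsStronglyContinuous ρ) (x : H) :
    IsClosed {g : GLbar F | ρ g x = x} :=
  isClosed_eq (hρ x) continuous_const

/-- The vector `ρ g h` is orthogonal to vectors fixed by the pointwise stabilizer of `W m`, if
`g (W α.hi)` is contained in the kernel of the `m`-th coordinate. -/
theorem inner_eq_zero_of_coord_eq_zero [CompleteSpace H] (hρ : IsStronglyContinuous ρ) {α : Seg} {h : H}
    (hh : h ∈ fixedVectors ρ (Qbar F α)) {g : GLbar F} {m : ℤ}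
    (hg : ∀ v ∈ W F α.hi, (g.1 v) m = 0) {y : H}
    (hy : ∀ q : GLbar F, (∀ v ∈ W F m, q.1 v = v) → ρ q y = y)
    (hX : ∀ β : Seg, β.hi = m - 1 → fixedVectors ρ (Qbar F β) = ⊥) :
    inner ℂ (ρ g h) y = 0 := by
  obtain ⟨l, hml, hl⟩ : ∃ l, m ≤ l ∧ ∀ v ∈ W F α.hi, g.1 v ∈ W F l := by
    obtain ⟨l, hl⟩ := exists_map_W_le g.1 α.hi
    exact ⟨max m l, le_max_left _ _, fun v hv => W_mono (le_max_right _ _) (hl v hv)⟩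
  obtain ⟨k, hkm, hk⟩ : ∃ k, k ≤ m - 1 ∧ ∀ v ∈ W F k, (g⁻¹).1 v ∈ W F α.lo := by
    obtain ⟨k, hk⟩ := exists_le_map_W (g⁻¹).1 α.lo
    exact ⟨min (m - 1) k, min_le_left _ _, fun v hv => hk v (W_mono (min_le_right _ _) hv)⟩
  -- These push the coordinates (m, l] beyond l + n and fix `W m` pointwise, so each of them fixes
  -- `y`.
  let q : ℕ → GLbar F := fun n => shiftSwap F m l (l - m + n) (by omega) (by omega)
  have hq : ∀ n, ∀ v ∈ W F m, (q n).1 v = v := fun n v hv =>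
    SeqSpace.ext (apply_shiftIndex_of_mem_W (by omega) hv)
  obtain ⟨x, hx, hxr⟩ := exists_weak_limit ρ q (ρ g h)
  rw [← hx y fun n => hy _ (hq n)]
  have hfix : x ∈ fixedVectors ρ (Qbar F ⟨k, m - 1, hkm⟩) := by
    intro r hr
    rw [mem_Qbar_iff] at hr
    refine mem_of_isClosed_of_approx (isClosed_stabilizer hρ x) (r := r) fun k' l' => ?_
    -- Once l + n ≥ J, a vector of q_n g(`W α.hi`) is a vector of `W (m - 1)` plus one fixed by `s`;
    -- coordinate `m` is absent by hypothesis. So `s` changes it only by an element of `W k`, which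
    -- lies in g(`W α.lo`).
    obtain ⟨s, hs, J, hJ⟩ := exists_eq_on_W_fix_Phi r (max l' (m - 1))
    refine ⟨s, hxr s ?_, fun v hv => ?_⟩
    · filter_upwards [Filter.eventually_ge_atTop (J - l).toNat] with n hn
      refine rep_apply_eq_self_of_conj hh (mem_Qbar_iff.2 fun v hv => ?_)
      have h1 : low F m (g.1 v) ∈ W F (m - 1) := fun j hj => by
        rw [low_apply]
        split_ifs with hjm
        · rw [show j = m by omega, hg v hv]
        · rfl
      have h2 : (q n).1 (high F m (g.1 v)) ∈ Phi F J := fun j hj => by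
        change (high F m (g.1 v)) (shiftIndex m l (l - m + n) j) = 0
        rw [high_apply]
        split_ifs with h3
        · rfl
        · refine hl v hv _ ?_
          unfold shiftIndex at h3 ⊢
          split_ifs at h3 ⊢ <;> omega
      have h3 : (q n).1 (g.1 v) = low F m (g.1 v) + (q n).1 (high F m (g.1 v)) := by
        conv_lhs => rw [← low_add_high m (g.1 v), map_add, hq n _ (low_mem_W _ _)]
      have h4 : s.1 ((q n).1 (g.1 v)) - (q n).1 (g.1 v) ∈ W F k := by
        rw [h3, map_add, hJ _ h2, add_sub_add_right_eq_sub, hs _ (W_mono (le_max_right _ _) h1)]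
        exact hr _ h1
      have h5 : ((q n)⁻¹).1 (s.1 ((q n).1 (g.1 v)) - (q n).1 (g.1 v)) =
          s.1 ((q n).1 (g.1 v)) - (q n).1 (g.1 v) := by
        conv_lhs => rw [← hq n _ (W_mono (by omega) h4)]
        rw [inv_val_apply_self]
      rw [map_sub, inv_val_apply_self] at h5
      have h6 := hk _ h4
      rw [← h5, map_sub, inv_val_apply_self] at h6
      exact h6
    · rw [hs v (W_mono (le_max_left _ _) hv), sub_self]
      exact zero_mem _
  rw [hX _ rfl, Submodule.mem_bot] at hfix
  rw [hfix, inner_zero_left]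

/-- The vector `ρ g h` is orthogonal to vectors fixed by all operators which are the identity modulo
`W m`, if `g (W α.lo)` contains the basis vector with number `m + 1`. -/
theorem inner_eq_zero_of_basisVec_mem [CompleteSpace H] (hρ : IsStronglyContinuous ρ) {α : Seg} {h : H}
    (hh : h ∈ fixedVectors ρ (Qbar F α)) {g : GLbar F} {m : ℤ}
    (hg : (g⁻¹).1 (basisVec F (m + 1)) ∈ W F α.lo) {y : H}
    (hy : ∀ q : GLbar F, (∀ v, q.1 v - v ∈ W F m) → ρ q y = y)
    (hX : ∀ β : Seg, β.lo = m + 1 → fixedVectors ρ (Qbar F β) = ⊥) :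
    inner ℂ (ρ g h) y = 0 := by
  obtain ⟨l, hml, hl⟩ : ∃ l, m + 1 ≤ l ∧ ∀ v ∈ W F α.hi, g.1 v ∈ W F l := by
    obtain ⟨l, hl⟩ := exists_map_W_le g.1 α.hi
    exact ⟨max (m + 1) l, le_max_left _ _, fun v hv => W_mono (le_max_right _ _) (hl v hv)⟩
  obtain ⟨k, hkm, hk⟩ : ∃ k, k ≤ m ∧ ∀ v ∈ W F k, (g⁻¹).1 v ∈ W F α.lo := by
    obtain ⟨k, hk⟩ := exists_le_map_W (g⁻¹).1 α.lo
    exact ⟨min m k, min_le_left _ _, fun v hv => hk v (W_mono (min_le_right _ _) hv)⟩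
  -- Here the block (k − n, m] is exchanged with the adjacent block of equal length below it, so
  -- everything between `k` and `m` sinks below k − n.
  let q : ℕ → GLbar F := fun n =>
    shiftSwap F (k - n - (m - k + n)) (k - n) (m - k + n) (by omega) (by omega)
  have hqa : ∀ n v j, ((q n).1 v) j =
      v (shiftIndex (k - n - (m - k + n)) (k - n) (m - k + n) j) := fun _ _ _ => rfl
  have hq : ∀ n v, (q n).1 v - v ∈ W F m := fun n v j hj => by
    rw [SeqSpace.sub_apply, hqa, sub_eq_zero, shiftIndex_of_lt (by omega) (by omega)]
  obtain ⟨x, hx, hxr⟩ := exists_weak_limit ρ q (ρ g h)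
  rw [← hx y fun n => hy _ (hq n)]
  have hfix : x ∈ fixedVectors ρ (Qbar F ⟨m + 1, l, hml⟩) := by
    intro r hr
    rw [mem_Qbar_iff] at hr
    refine mem_of_isClosed_of_approx (isClosed_stabilizer hρ x) (r := r) fun k' l' => ?_
    obtain ⟨s, hs, J, hJ⟩ := exists_sub_mem_W_fix_coord r (min k' (m + 1))
    refine ⟨s, hxr s ?_, fun v _ => W_mono (min_le_left _ _) (hs v)⟩
    filter_upwards [Filter.eventually_ge_atTop (k - J).toNat] with n hn
    refine rep_apply_eq_self_of_conj hh (mem_Qbar_iff.2 fun v hv => ?_)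
    set w := (q n).1 (g.1 v) with hw
    have hwl : w ∈ W F l := by
      have h1 := W_mono (show m ≤ l by omega) (hq n (g.1 v))
      simpa using Submodule.add_mem _ h1 (hl v hv)
    have hd : s.1 w - w ∈ W F (m + 1) := by
      have h1 := Submodule.add_mem _ (W_mono (min_le_right _ _) (hs w)) (hr w hwl)
      simpa using h1
    -- The difference lies in `W (m + 1)` and has no coordinates up to `J ≥ k - n`. After `q n` only
    -- coordinate m + 1 and coordinates in `W k` remain, and g⁻¹ sends both into `W α.lo`.
    have h2 : (q n).1 (s.1 w - w) - (s.1 w - w) (m + 1) • basisVec F (m + 1) ∈ W F k := by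
      intro j hj
      rw [SeqSpace.sub_apply, SeqSpace.smul_apply, hqa]
      rcases lt_trichotomy j (m + 1) with h1 | rfl | h1
      · rw [basisVec_of_ne h1.ne, mul_zero, sub_zero]
        refine hJ w _ ?_
        unfold shiftIndex
        split_ifs <;> omega
      · rw [basisVec_same, mul_one, sub_eq_zero,
          shiftIndex_of_lt (by omega) (by omega)]
      · rw [basisVec_of_ne h1.ne', mul_zero, sub_zero]
        refine hd _ ?_
        unfold shiftIndex
        split_ifs <;> omega
    have h3 : (g⁻¹).1 ((q n).1 (s.1 w - w)) ∈ W F α.lo := by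
      have h4 := Submodule.add_mem _ (hk _ h2)
        (Submodule.smul_mem _ ((s.1 w - w) (m + 1)) hg)
      rwa [← map_smul, ← map_add, sub_add_cancel] at h4
    have h4 : ((q n)⁻¹).1 w = g.1 v := by rw [hw, inv_val_apply_self]
    have h5 : (q n)⁻¹ = q n := shiftSwap_inv _ _ _ _ _
    rw [← h5, map_sub, h4, map_sub, inv_val_apply_self] at h3
    exact h3
  rw [hX _ rfl, Submodule.mem_bot] at hfix
  rw [hfix, inner_zero_left]

theorem fixedVectors_eq_bot_of_Xi_eq {α β : Seg} (hX : Xi ρ = {β | α ≤ β}) (h : ¬ α ≤ β) :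
    fixedVectors ρ (Qbar F β) = ⊥ := by
  by_contra h1
  exact h (hX.subset h1)

/-- If a linear subspace `g (W a)` does not contain `W b`, then some `p ∈ GLbar` preserving `W b` maps
`g (W a)` to the kernel of the coordinate `b`. -/
theorem exists_coord_eq_zero {g : GLbar F} {a b : ℤ} {w : SeqSpace F} (hw : w ∈ W F b)
    (hgw : (g⁻¹).1 w ∉ W F a) :
    ∃ p : GLbar F, (∀ v ∈ W F b, p.1 v ∈ W F b) ∧ ∀ v ∈ W F a, (p.1 (g.1 v)) b = 0 := by
  obtain ⟨ψ, hψw, hψ⟩ := Submodule.exists_le_ker_of_notMem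
    (p := (W F a).map g.1.toLinearMap) (mt mem_map_val.1 hgw)
  obtain ⟨k, hkb, hk⟩ : ∃ k, k < b ∧ ∀ v ∈ W F k, (g⁻¹).1 v ∈ W F a := by
    obtain ⟨k, hk⟩ := exists_le_map_W (g⁻¹).1 a
    exact ⟨min (b - 1) k, by omega, fun v hv => hk v (W_mono (min_le_right _ _) hv)⟩
  have hψk : ∀ v ∈ W F k, ψ v = 0 := fun v hv => hψ (mem_map_val.2 (hk v hv))
  obtain ⟨i, hki, hib, hi⟩ : ∃ i, k < i ∧ i ≤ b ∧ ψ (basisVec F i) ≠ 0 := by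
    by_contra! hcon
    have h1 := hψk _ (sub_sum_mem ⟨k, b, hkb.le⟩ hw)
    rw [map_sub, map_sum, Finset.sum_eq_zero, sub_zero] at h1
    · exact hψw h1
    · intro j _
      have := Seg.idx_mem ⟨k, b, hkb.le⟩ j
      rw [map_smul, hcon _ this.1 this.2, smul_zero]
  let σ : GLbar F := ⟨swapOp F i b, swapOp_mem i b⟩
  have hσ : ∀ v j, (σ.1 v) j = v (Equiv.swap i b j) := fun _ _ => rfl
  have hσσ : ∀ v, σ.1 (σ.1 v) = v := fun v => by
    ext j
    rw [hσ, hσ, Equiv.swap_apply_self]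
  have hσk : ∀ v ∈ W F k, σ.1 v = v := fun v hv => by
    ext j
    rw [hσ, Equiv.swap_apply_def]
    split_ifs with h1 h2
    · rw [h1, hv i hki, hv b hkb]
    · rw [h2, hv i hki, hv b hkb]
    · rfl
  have hσb : σ.1 (basisVec F b) = basisVec F i := by
    ext j
    rw [hσ, basisVec_apply, basisVec_apply, Equiv.swap_apply_def]
    split_ifs <;> first | rfl | omega
  -- With this φ, coordinate `b` of `t * σ` is exactly ψ, which kills g(`W a`). The swap is there to
  -- make the shear invertible: 1 + φ(e_b) = ψ(e_i) ≠ 0.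
  let φ : SeqSpace F →ₗ[F] F := ψ.comp σ.1.toLinearMap - coord F b
  have hφ : ∀ v, φ v = ψ (σ.1 v) - v b := fun _ => rfl
  let t : GLbar F := shear φ (basisVec F b) k
    (fun u hu => by rw [hφ, hσk u hu, hψk u hu, hu b hkb, sub_zero])
    (by rwa [hφ, hσb, basisVec_same, add_sub_cancel])
  refine ⟨t * σ, fun v hv => ?_, fun v hv => ?_⟩
  · rw [mul_val_apply, shear_apply]
    refine Submodule.add_mem _ (fun j hj => ?_)
      (Submodule.smul_mem _ _ (basisVec_mem_W.2 le_rfl))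
    rw [hσ, Equiv.swap_apply_of_ne_of_ne (by omega) (by omega)]
    exact hv j hj
  · rw [mul_val_apply, shear_apply, hφ, hσσ, SeqSpace.add_apply, SeqSpace.smul_apply, basisVec_same,
      mul_one, add_sub_cancel]
    exact hψ ⟨v, hv, rfl⟩

/-- A vector outside `W m` can be mapped to the basis vector with number `m + 1` by an element of
`GLbar` fixing `W m` pointwise. -/
theorem exists_map_eq_basisVec {m : ℤ} {a : SeqSpace F} (ha : a ∉ W F m) :
    ∃ p : GLbar F, (∀ v ∈ W F m, p.1 v = v) ∧ p.1 a = basisVec F (m + 1) := by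
  obtain ⟨i, hi, hai⟩ : ∃ i, m < i ∧ a i ≠ 0 := by
    by_contra! hcon
    exact ha fun j hj => hcon j hj
  let σ : GLbar F := ⟨swapOp F (m + 1) i, swapOp_mem _ _⟩
  have hσ : ∀ v j, (σ.1 v) j = v (Equiv.swap (m + 1) i j) := fun _ _ => rfl
  have hσm : ∀ v ∈ W F m, σ.1 v = v := fun v hv => by
    ext j
    rw [hσ, Equiv.swap_apply_def]
    split_ifs with h1 h2
    · rw [h1, hv i hi, hv _ (by omega)]
    · rw [h2, hv i hi, hv _ (by omega)]
    · rfl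
  have hc : (σ.1 a) (m + 1) ≠ 0 := by
    rwa [hσ, Equiv.swap_apply_left]
  set c := (σ.1 a) (m + 1) with hcdef
  let φ : SeqSpace F →ₗ[F] F := c⁻¹ • coord F (m + 1)
  have hφ : ∀ v, φ v = c⁻¹ * v (m + 1) := fun _ => rfl
  -- The shear replaces the coefficient vector σa by e_{m+1}; the invertibility factor is c⁻¹.
  let t : GLbar F := shear φ (basisVec F (m + 1) - σ.1 a) m
    (fun u hu => by rw [hφ, hu _ (by omega), mul_zero])
    (by
      rw [hφ, SeqSpace.sub_apply, basisVec_same, ← hcdef, mul_sub, inv_mul_cancel₀ hc, mul_one,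
        add_sub_cancel]
      exact inv_ne_zero hc)
  refine ⟨t * σ, fun v hv => ?_, ?_⟩
  · rw [mul_val_apply, hσm v hv, shear_apply, hφ, hv _ (by omega), mul_zero, zero_smul, add_zero]
  · rw [mul_val_apply, shear_apply, hφ, ← hcdef, inv_mul_cancel₀ hc, one_smul, add_sub_cancel]

/-- If non-zero `Q̄_β`-fixed vectors exist only for `β ≥ α`, then the translates of the space of
`Q̄_α`-fixed vectors by different cosets of `P̄_α` are orthogonal. -/
theorem inner_eq_zero_of_notMem_Pbar [CompleteSpace H] (hρ : IsStronglyContinuous ρ) {α : Seg}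
    (hX : Xi ρ = {β | α ≤ β}) {h h' : H} (hh : h ∈ fixedVectors ρ (Qbar F α))
    (hh' : h' ∈ fixedVectors ρ (Qbar F α)) {g : GLbar F} (hg : g ∉ Pbar F α) :
    inner ℂ (ρ g h) h' = 0 := by
  -- By rigidity, either `W α.hi` is not contained in its image under `g`, or the two coincide and
  -- then g(`W α.lo`) leaves `W α.lo`. In each case an auxiliary `p` moves the situation to standard
  -- position, replacing h' by ρ(p)h'.
  by_cases hhi : ∀ v ∈ W F α.hi, (g⁻¹).1 v ∈ W F α.hi
  · by_cases hlo : ∀ v ∈ W F α.lo, g.1 v ∈ W F α.lo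
    · refine absurd (mem_Pbar_of_forall hlo fun v hv => ?_) hg
      have := inv_mem_W_of_forall hhi hv
      rwa [inv_inv] at this
    · push Not at hlo
      obtain ⟨v, hv, hgv⟩ := hlo
      obtain ⟨p, hp, hpa⟩ := exists_map_eq_basisVec hgv
      rw [← LinearIsometryEquiv.inner_map_map (ρ p), ← map_mul_rep_apply]
      refine inner_eq_zero_of_basisVec_mem hρ hh (m := α.lo) ?_ (fun q hq => ?_) fun β hβ => ?_
      · rwa [← hpa, ← mul_val_apply, ← mul_val_apply, show (p * g)⁻¹ * p * g = 1 by group]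
      · refine rep_apply_eq_self_of_conj hh' (mem_Qbar_iff.2 fun u _ => ?_)
        have h1 : p.1 ((p⁻¹).1 (q.1 (p.1 u) - p.1 u)) = (p⁻¹).1 (q.1 (p.1 u) - p.1 u) :=
          hp _ (inv_mem_W_of_forall (fun v hv => (hp v hv).symm ▸ hv) (hq _))
        rw [val_apply_inv_self, map_sub, inv_val_apply_self] at h1
        have h2 := hq (p.1 u)
        rw [h1] at h2
        exact h2
      · refine fixedVectors_eq_bot_of_Xi_eq hX fun h1 => ?_
        have := h1.1
        omega
  · push Not at hhi
    obtain ⟨w, hw, hgw⟩ := hhi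
    obtain ⟨p, hp, hpg⟩ := exists_coord_eq_zero hw hgw
    rw [← LinearIsometryEquiv.inner_map_map (ρ p), ← map_mul_rep_apply]
    refine inner_eq_zero_of_coord_eq_zero hρ hh (m := α.hi) hpg (fun q hq => ?_) fun β hβ => ?_
    · refine rep_apply_eq_self_of_conj hh' (mem_Qbar_iff.2 fun u hu => ?_)
      have h1 : ((p⁻¹ * q * p).1 u) = u := by
        rw [mul_val_apply, mul_val_apply, hq _ (hp u hu), inv_val_apply_self]
      rw [h1, sub_self]
      exact zero_mem _
    · refine fixedVectors_eq_bot_of_Xi_eq hX fun h1 => ?_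
      have := h1.2
      omega

end Orthogonality

/-! ### Induced representations of a general group: fixed vectors, irreducibility, recognition. -/

section InducedGeneral

variable {G : Type*} [Group G] (P : Subgroup G)
  {L : Type*} [NormedAddCommGroup L] [InnerProductSpace ℂ L] (τ : P →* (L ≃ₗᵢ[ℂ] L))

open Classical in
/-- The functions on `G / P` supported by a point. -/
def indSingle (x : G ⧸ P) : L →ₗᵢ[ℂ] IndSpace P L where
  toFun v := lp.single (E := fun _ : G ⧸ P => L) 2 x v
  map_add' v w := lp.single_add (E := fun _ : G ⧸ P => L) 2 x v w
  map_smul' c v := lp.single_smul (E := fun _ : G ⧸ P => L) 2 x c v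
  norm_map' v := lp.norm_single (E := fun _ : G ⧸ P => L) two_pos x v

open Classical in
theorem indSingle_apply (x : G ⧸ P) (v : L) : indSingle P x v = lp.single (E := fun _ : G ⧸ P => L) 2 x v := rfl

theorem indSingle_apply_self (x : G ⧸ P) (v : L) : indSingle P x v x = v := by
  classical
  exact lp.single_apply_self (E := fun _ : G ⧸ P => L) 2 x v

theorem indSingle_apply_of_ne {x y : G ⧸ P} (h : y ≠ x) (v : L) : indSingle P x v y = 0 := by
  classical
  exact lp.single_apply_ne (E := fun _ : G ⧸ P => L) 2 x v h

variable {P} in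
theorem eq_indSingle {f : IndSpace P L} {x : G ⧸ P} (h : ∀ y, y ≠ x → f y = 0) :
    f = indSingle P x (f x) := by
  ext y
  by_cases hy : y = x
  · rw [hy, indSingle_apply_self]
  · rw [h y hy, indSingle_apply_of_ne P hy]

variable {P} in
/-- The functions supported by points are total in the space of the induced representation. -/
theorem mem_of_indSingle_mem {S : Submodule ℂ (IndSpace P L)} (hS : IsClosed (S : Set (IndSpace P L)))
    (h : ∀ x v, indSingle P x v ∈ S) (f : IndSpace P L) : f ∈ S := by
  classical
  have h1 := lp.hasSum_single (E := fun _ : G ⧸ P => L) (p := 2) (by norm_num) f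
  exact hS.mem_of_tendsto h1 (Filter.Eventually.of_forall fun s => S.sum_mem fun x _ => h x (f x))

theorem cosetRep_one : cosetRep P ((1 : G) : G ⧸ P) = 1 := if_pos rfl

theorem cosetRep_inv_smul (x : G ⧸ P) : (cosetRep P x)⁻¹ • x = ((1 : G) : G ⧸ P) := by
  conv_lhs => rw [← mk_cosetRep P x]
  rw [MulAction.Quotient.smul_coe, smul_eq_mul, mk_cosetRep, inv_mul_cancel]

variable {P} in
theorem smul_coset_one (p : P) : (p : G) • ((1 : G) : G ⧸ P) = ((1 : G) : G ⧸ P) := by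
  rw [MulAction.Quotient.smul_coe, smul_eq_mul, mul_one, QuotientGroup.eq, mul_one]
  exact P.inv_mem p.2

variable {P} in
theorem cosetCocycle_of_mem (p : P) : cosetCocycle P p ((1 : G) : G ⧸ P) = p := by
  have h : (p : G)⁻¹ • ((1 : G) : G ⧸ P) = ((1 : G) : G ⧸ P) := smul_coset_one p⁻¹
  ext
  simp [cosetCocycle, h, cosetRep_one]

theorem cosetCocycle_cosetRep (x : G ⧸ P) : cosetCocycle P (cosetRep P x) x = 1 := by
  ext
  simp only [cosetCocycle, cosetRep_inv_smul, cosetRep_one]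
  simp

theorem inducedRep_indSingle (g : G) (x : G ⧸ P) (v : L) :
    inducedRep P τ g (indSingle P x v) =
      indSingle P (g • x) (τ (cosetCocycle P g (g • x)) v) := by
  ext y
  rw [inducedRep_apply]
  by_cases hy : y = g • x
  · rw [hy, inv_smul_smul, indSingle_apply_self, indSingle_apply_self]
  · rw [indSingle_apply_of_ne P hy, indSingle_apply_of_ne P (fun h => hy (inv_smul_eq_iff.1 h)),
      map_zero]

theorem inducedRep_indSingle_of_mem (p : P) (v : L) :
    inducedRep P τ p (indSingle P ((1 : G) : G ⧸ P) v) =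
      indSingle P ((1 : G) : G ⧸ P) (τ p v) := by
  rw [inducedRep_indSingle, smul_coset_one, cosetCocycle_of_mem]

theorem inducedRep_cosetRep_indSingle (x : G ⧸ P) (v : L) :
    inducedRep P τ (cosetRep P x) (indSingle P ((1 : G) : G ⧸ P) v) = indSingle P x v := by
  have h : cosetRep P x • ((1 : G) : G ⧸ P) = x := by
    rw [← cosetRep_inv_smul P x, smul_inv_smul]
  rw [inducedRep_indSingle, h, cosetCocycle_cosetRep, map_one]
  rfl

variable {P τ} in
/-- A vector fixed by a subgroup `K` vanishes at the points with infinite `K`-orbits. -/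
theorem apply_eq_zero_of_injective {K : Subgroup G} {f : IndSpace P L}
    (hf : f ∈ fixedVectors (inducedRep P τ) K) {q : ℕ → G} (hq : ∀ n, q n ∈ K) {x : G ⧸ P}
    (hx : Function.Injective fun n => q n • x) : f x = 0 := by
  have h1 : ∀ n, ‖f (q n • x)‖ = ‖f x‖ := fun n => by
    conv_lhs => rw [← hf _ (hq n), inducedRep_apply, inv_smul_smul, LinearIsometryEquiv.norm_map]
  -- A constant summable over an infinite orbit must be zero.
  have h2 := (lp.hasSum_norm (by norm_num) f).summable.comp_injective hx
  have h3 : (fun y => ‖f y‖ ^ (2 : ENNReal).toReal) ∘ (fun n => q n • x) =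
      fun _ => ‖f x‖ ^ (2 : ENNReal).toReal := funext fun n => by
    simp only [Function.comp_apply, h1]
  rw [h3, summable_const_iff] at h2
  simpa using h2

/-- The projection to an invariant subspace commutes with the unitary action. -/
theorem starProjection_mem_fixedVectors {H : Type*} [NormedAddCommGroup H] [InnerProductSpace ℂ H]
    {ρ : G →* (H ≃ₗᵢ[ℂ] H)} {K : Subgroup G} {S : Submodule ℂ H} [S.HasOrthogonalProjection]
    (hS : ∀ g, ∀ v ∈ S, ρ g v ∈ S) {u : H} (hu : u ∈ fixedVectors ρ K) :
    S.starProjection u ∈ fixedVectors ρ K := by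
  intro k hk
  refine (Submodule.eq_starProjection_of_mem_orthogonal (hS k _ (Submodule.starProjection_apply_mem S u))
    ((Submodule.mem_orthogonal' _ _).2 fun w hw => ?_)).symm
  have h1 : u - ρ k (S.starProjection u) = ρ k (u - S.starProjection u) := by rw [map_sub, hu k hk]
  rw [h1, inner_rep_left]
  exact (Submodule.mem_orthogonal' _ _).1 (Submodule.sub_starProjection_mem_orthogonal u) _ (hS _ _ hw)

/-- An induced representation is irreducible, if `τ` is irreducible and some subgroup fixes precisely
the functions supported by the initial point. -/
theorem inducedRep_irreducible [CompleteSpace L] (hτ : IsIrreducibleRep τ) {K : Subgroup G}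
    (hK : ∀ f, f ∈ fixedVectors (inducedRep P τ) K ↔ ∃ v, indSingle P ((1 : G) : G ⧸ P) v = f) :
    IsIrreducibleRep (inducedRep P τ) := by
  obtain ⟨hL, hτ⟩ := hτ
  refine ⟨(indSingle P ((1 : G) : G ⧸ P) (L := L)).injective.nontrivial, fun S hSc hS => ?_⟩
  have hSL := hτ (S.comap (indSingle P ((1 : G) : G ⧸ P)).toLinearMap)
    (hSc.preimage (indSingle P ((1 : G) : G ⧸ P)).continuous) fun p v hv => by
      change indSingle P _ (τ p v) ∈ S
      rw [← inducedRep_indSingle_of_mem]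
      exact hS _ _ hv
  rcases hSL with h | h
  · left
    have : CompleteSpace S := hSc.completeSpace_coe
    -- The projection of a function at the base point is again `K`-fixed, so it lies both in the
    -- copy of `L` and in `S`; their intersection is zero here.
    have h1 : ∀ v, indSingle P ((1 : G) : G ⧸ P) v ∈ Sᗮ := fun v => by
      obtain ⟨w, hw⟩ := (hK _).1 (starProjection_mem_fixedVectors hS ((hK _).2 ⟨v, rfl⟩))
      have h2 : w ∈ S.comap (indSingle P ((1 : G) : G ⧸ P)).toLinearMap := by
        change indSingle P _ w ∈ S
        rw [hw]
        exact Submodule.starProjection_apply_mem _ _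
      rw [h, Submodule.mem_bot] at h2
      rw [h2, map_zero] at hw
      exact (Submodule.starProjection_apply_eq_zero_iff _).1 hw.symm
    refine (Submodule.eq_bot_iff S).2 fun f hf => ?_
    ext x
    refine ext_inner_left ℂ fun v => ?_
    classical
    rw [← lp.inner_single_left (𝕜 := ℂ) (G := fun _ : G ⧸ P => L) x v f]
    -- Translating by a coset representative turns orthogonality at the base point into vanishing at
    -- `x`.
    have h2 := (Submodule.mem_orthogonal' _ _).1 (h1 v) _ (hS (cosetRep P x)⁻¹ f hf)
    rw [← inner_rep_left, inducedRep_cosetRep_indSingle, indSingle_apply] at h2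
    convert h2
    simp
  · right
    refine eq_top_iff.2 fun f _ => mem_of_indSingle_mem hSc (fun x v => ?_) f
    rw [← inducedRep_cosetRep_indSingle P τ]
    exact hS _ _ (show v ∈ S.comap (indSingle P ((1 : G) : G ⧸ P)).toLinearMap from h ▸ trivial)

variable {P τ} in
/-- An irreducible representation is equivalent to an induced representation, if it contains the
inducing representation of `P` so that its translates by different cosets are orthogonal. -/
theorem unitarilyEquivalent_inducedRep [CompleteSpace L] [Nontrivial L]
    {H : Type*} [NormedAddCommGroup H] [InnerProductSpace ℂ H] [CompleteSpace H]
    {ρ : G →* (H ≃ₗᵢ[ℂ] H)} (hρ : IsIrreducibleRep ρ) (J : L →ₗᵢ[ℂ] H)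
    (hJ : ∀ (p : P) v, J (τ p v) = ρ p (J v))
    (hort : ∀ g, g ∉ P → ∀ v w, inner ℂ (ρ g (J v)) (J w) = 0) :
    UnitarilyEquivalent ρ (inducedRep P τ) := by
  let V : G ⧸ P → L →ₗᵢ[ℂ] H := fun x => (ρ (cosetRep P x)).toLinearIsometry.comp J
  have hV : ∀ x v, V x v = ρ (cosetRep P x) (J v) := fun _ _ => rfl
  have htrans : ∀ g x v, ρ g (V x v) = V (g • x) (τ (cosetCocycle P g (g • x)) v) := by
    intro g x v
    rw [hV, hV, hJ, ← map_mul_rep_apply, ← map_mul_rep_apply]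
    congr 2
    simp [cosetCocycle]
  have hfam : OrthogonalFamily ℂ (fun _ : G ⧸ P => L) V := by
    intro x y hxy v w
    rw [hV, hV, ← rep_apply_inv_self ρ (cosetRep P y) (ρ (cosetRep P x) (J v)),
      LinearIsometryEquiv.inner_map_map, ← map_mul_rep_apply]
    refine hort _ (fun h => hxy ?_) v w
    rw [← QuotientGroup.eq, mk_cosetRep, mk_cosetRep] at h
    exact h.symm
  let S := (⨆ x, LinearMap.range (V x).toLinearMap).topologicalClosure
  have hVS : ∀ x v, V x v ∈ ⨆ x, LinearMap.range (V x).toLinearMap := fun x v =>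
    Submodule.mem_iSup_of_mem x ⟨v, rfl⟩
  have hSinv : ∀ g, ∀ v ∈ S, ρ g v ∈ S := by
    intro g
    have h1 : (⨆ x, LinearMap.range (V x).toLinearMap) ≤ S.comap (ρ g).toLinearEquiv.toLinearMap :=
      iSup_le fun x => by
        rintro _ ⟨v, rfl⟩
        change ρ g (V x v) ∈ S
        rw [htrans]
        exact Submodule.le_topologicalClosure _ (hVS _ _)
    exact Submodule.topologicalClosure_minimal _ h1
      ((Submodule.isClosed_topologicalClosure _).preimage (ρ g).continuous)
  -- The closed span of the translates is invariant and non-zero, so irreducibility makes it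
  -- everything.
  have hStop : S = ⊤ := by
    refine (hρ.2 S (Submodule.isClosed_topologicalClosure _) hSinv).resolve_left fun h => ?_
    obtain ⟨v, hv⟩ := exists_ne (0 : L)
    have h1 : V ((1 : G) : G ⧸ P) v ∈ S := Submodule.le_topologicalClosure _ (hVS _ v)
    rw [h, Submodule.mem_bot, ← norm_eq_zero, LinearIsometry.norm_map, norm_eq_zero] at h1
    exact hv h1
  have hsum : IsHilbertSum ℂ (fun _ : G ⧸ P => L) V := IsHilbertSum.mk hfam hStop.ge
  let E := hsum.linearIsometryEquiv
  have hE : ∀ x v, E.symm (indSingle P x v) = V x v := fun x v => by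
    classical
    rw [indSingle_apply]
    convert hsum.linearIsometryEquiv_symm_apply_single v
  have key : ∀ g f, E.symm (inducedRep P τ g f) = ρ g (E.symm f) := by
    intro g f
    let A : IndSpace P L →ₗ[ℂ] H := (E.symm.toLinearEquiv.toLinearMap.comp
      (inducedRep P τ g).toLinearEquiv.toLinearMap) -
      ((ρ g).toLinearEquiv.toLinearMap.comp E.symm.toLinearEquiv.toLinearMap)
    have hA : ∀ f, A f = E.symm (inducedRep P τ g f) - ρ g (E.symm f) := fun _ => rfl
    have hcont : Continuous A :=
      (E.symm.continuous.comp (inducedRep P τ g).continuous).sub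
        ((ρ g).continuous.comp E.symm.continuous)
    have h1 := mem_of_indSingle_mem (S := LinearMap.ker A) (isClosed_singleton.preimage hcont)
      (fun x v => by rw [LinearMap.mem_ker, hA, inducedRep_indSingle, hE, hE, htrans, sub_self]) f
    rwa [LinearMap.mem_ker, hA, sub_eq_zero] at h1
  refine ⟨E, fun g v => ?_⟩
  rw [← E.apply_symm_apply (inducedRep P τ g (E v)), key, E.symm_apply_apply]

theorem isIrreducibleRep_comp {K : Type*} [Group K] {σ : G →* (L ≃ₗᵢ[ℂ] L)}
    (hσ : IsIrreducibleRep σ) {φ : K →* G} (hφ : Function.Surjective φ) :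
    IsIrreducibleRep (σ.comp φ) :=
  ⟨hσ.1, fun S hS h => hσ.2 S hS fun g v hv => by
    obtain ⟨k, rfl⟩ := hφ g
    exact h k v hv⟩

/-- An irreducible representation of a finite group is finite-dimensional. -/
theorem finiteDimensional_of_irreducible [Finite G] {σ : G →* (L ≃ₗᵢ[ℂ] L)}
    (hσ : IsIrreducibleRep σ) : FiniteDimensional ℂ L := by
  obtain ⟨hL, hσ⟩ := hσ
  obtain ⟨v, hv⟩ := exists_ne (0 : L)
  let S := Submodule.span ℂ (Set.range fun g => σ g v)
  have hfin : FiniteDimensional ℂ S := FiniteDimensional.span_of_finite ℂ (Set.finite_range _)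
  have hinv : ∀ g, ∀ w ∈ S, σ g w ∈ S := by
    intro g
    have : S ≤ S.comap (σ g).toLinearEquiv.toLinearMap := by
      refine Submodule.span_le.2 ?_
      rintro _ ⟨h, rfl⟩
      refine Submodule.subset_span ⟨g * h, ?_⟩
      exact map_mul_rep_apply σ g h v
    exact this
  rcases hσ S (Submodule.closed_of_finiteDimensional S) hinv with h | h
  · have h1 : σ 1 v ∈ S := Submodule.subset_span ⟨1, rfl⟩
    rw [h, Submodule.mem_bot, map_one] at h1
    exact absurd h1 hv
  · rw [h] at hfin
    exact Module.Finite.equiv (Submodule.topEquiv (R := ℂ) (M := L))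

end InducedGeneral

/-! ### The representation T: countability, fixed vectors, continuity and data. -/

section InducedFromBlock

variable {F : Type*} [Field F] [Finite F]

/-- There are countably many subspaces containing some `W k` and contained in some `W l`. -/
theorem countable_setOf_between_W :
    {A : Submodule F (SeqSpace F) | ∃ k l, W F k ≤ A ∧ A ≤ W F l}.Countable := by
  have h : ∀ k l, {A : Submodule F (SeqSpace F) | W F k ≤ A ∧ A ≤ W F l}.Finite := by
    intro k l
    -- A subspace between `W k` and `W l` is determined by its trace on the finite complement of `W
    -- k` in `W l`.
    refine Set.Finite.of_injOn (t := Set.univ)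
      (f := fun A => {z : ↥(Phi F k ⊓ W F l) | z.1 ∈ A}) (fun _ _ => trivial) ?_ (Set.toFinite _)
    have key : ∀ A B : Submodule F (SeqSpace F), W F k ≤ A → A ≤ W F l → W F k ≤ B →
        {z : ↥(Phi F k ⊓ W F l) | z.1 ∈ A} = {z : ↥(Phi F k ⊓ W F l) | z.1 ∈ B} → A ≤ B := by
      intro A B hA hA' hB hAB v hv
      have h1 : high F k v ∈ A := by
        rw [← add_sub_cancel_left (low F k v) (high F k v), low_add_high]
        exact A.sub_mem hv (hA (low_mem_W k v))
      have h2 : (⟨high F k v, high_mem_Phi _ _, high_mem_W (hA' hv)⟩ : ↥(Phi F k ⊓ W F l)) ∈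
          {z : ↥(Phi F k ⊓ W F l) | z.1 ∈ B} := hAB ▸ h1
      rw [← low_add_high k v]
      exact B.add_mem (hB (low_mem_W k v)) h2
    exact fun A hA B hB hAB =>
      le_antisymm (key A B hA.1 hA.2 hB.1 hAB) (key B A hB.1 hB.2 hA.1 hAB.symm)
  refine (Set.countable_iUnion fun k : ℤ => Set.countable_iUnion fun l : ℤ =>
    (h k l).countable).mono ?_
  rintro A ⟨k, l, hkl⟩
  exact Set.mem_iUnion.2 ⟨k, Set.mem_iUnion.2 ⟨l, hkl⟩⟩

theorem map_W_mem_between (g : GLbar F) (a : ℤ) : (W F a).map g.1.toLinearMap ∈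
    {A : Submodule F (SeqSpace F) | ∃ k l, W F k ≤ A ∧ A ≤ W F l} := by
  obtain ⟨k, hk⟩ := exists_le_map_W (g⁻¹).1 a
  obtain ⟨l, hl⟩ := exists_map_W_le g.1 a
  refine ⟨k, l, fun v hv => mem_map_val.2 (hk v hv), ?_⟩
  rintro _ ⟨v, hv, rfl⟩
  exact hl v hv

/-- A coset is determined by its flag, a pair of subspaces from a countable set. -/
theorem countable_quotient_Pbar (α : Seg) : Countable (GLbar F ⧸ Pbar F α) := by
  let X := {A : Submodule F (SeqSpace F) | ∃ k l, W F k ≤ A ∧ A ≤ W F l}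
  have hX : Countable X := countable_setOf_between_W.to_subtype
  let f : GLbar F ⧸ Pbar F α → X × X := fun x =>
    (⟨_, map_W_mem_between (cosetRep _ x) α.lo⟩, ⟨_, map_W_mem_between (cosetRep _ x) α.hi⟩)
  refine Function.Injective.countable (f := f) fun x y hxy => ?_
  have h1 := congrArg Subtype.val (congrArg Prod.fst hxy)
  have h2 := congrArg Subtype.val (congrArg Prod.snd hxy)
  rw [← mk_cosetRep _ x, ← mk_cosetRep _ y, QuotientGroup.eq]
  have key : ∀ a, (W F a).map (cosetRep (Pbar F α) x).1.toLinearMap =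
      (W F a).map (cosetRep (Pbar F α) y).1.toLinearMap →
      ∀ v ∈ W F a, ((cosetRep (Pbar F α) x)⁻¹ * cosetRep (Pbar F α) y).1 v ∈ W F a := by
    intro a ha v hv
    rw [mul_val_apply]
    refine mem_map_val.1 ?_
    rw [ha]
    exact ⟨v, hv, rfl⟩
  exact mem_Pbar_of_forall (key _ h1) (key _ h2)

variable {α : Seg} {L : Type*} [NormedAddCommGroup L] [InnerProductSpace ℂ L]
  (τ : GL (Fin α.len) F →* (L ≃ₗᵢ[ℂ] L))

theorem Qbar_anti {α β : Seg} (h : α ≤ β) : Qbar F β ≤ Qbar F α := fun _ hg =>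
  mem_Qbar_iff.2 fun v hv => W_mono h.1 (mem_Qbar_iff.1 hg v (W_mono h.2 hv))

theorem indSingle_one_mem_fixedVectors {β : Seg} (h : α ≤ β) (v : L) :
    indSingle (Pbar F α) ((1 : GLbar F) : GLbar F ⧸ Pbar F α) v ∈
      fixedVectors (inducedFromBlock α τ) (Qbar F β) := by
  intro q hq
  have hq' := Qbar_anti h hq
  have h1 := inducedRep_indSingle_of_mem (Pbar F α) (τ.comp (blockHom F α))
    ⟨q, Qbar_le_Pbar α hq'⟩ v
  have h2 : blockHom F α ⟨q, Qbar_le_Pbar α hq'⟩ = 1 := blockHom_eq_one_iff.2 hq'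
  rw [MonoidHom.comp_apply, h2, map_one] at h1
  exact h1

variable {τ} in
/-- A `Q̄_β`-fixed vector of the induced representation is supported by the pairs of subspaces lying
between `W β.lo` and `W β.hi`. -/
theorem between_of_apply_ne_zero {β : Seg} {f : IndSpace (Pbar F α) L}
    (hf : f ∈ fixedVectors (inducedFromBlock α τ) (Qbar F β)) {g : GLbar F}
    (hg : f (g : GLbar F ⧸ Pbar F α) ≠ 0) :
    (∀ v ∈ W F β.lo, (g⁻¹).1 v ∈ W F α.lo) ∧ ∀ v ∈ W F α.hi, g.1 v ∈ W F β.hi := by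
  have hcoset : ∀ q q' : GLbar F, q • (g : GLbar F ⧸ Pbar F α) = q' • (g : GLbar F ⧸ Pbar F α) →
      g⁻¹ * q⁻¹ * (q' * g) ∈ Pbar F α := fun q q' h => by
    rw [MulAction.Quotient.smul_coe, MulAction.Quotient.smul_coe, smul_eq_mul, smul_eq_mul,
      QuotientGroup.eq, mul_inv_rev] at h
    exact h
  constructor
  · by_contra! hcon
    obtain ⟨v, hv, hgv⟩ := hcon
    obtain ⟨k, hk⟩ := exists_le_map_W (g⁻¹).1 α.lo
    let u := high F k v
    have hu : ∀ j, j ≤ k → u j = 0 := high_mem_Phi k v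
    have hgu : (g⁻¹).1 u ∉ W F α.lo := fun h => hgv (by
      rw [← low_add_high k v, map_add]
      exact Submodule.add_mem _ (hk _ (low_mem_W _ _)) h)
    -- Adding multiples of `u ∈ W β.lo` stays in Q̄_β. Truncation made `u` vanish up to `k`, so the
    -- shears are unipotent. If two of them agreed on the coset, e_{k−n'} + u would lie in g(`W
    -- α.lo`); since e_{k−n'} does, so would `u`.
    let q : ℕ → GLbar F := fun n => shear (coord F (k - n)) u (k - n - 1)
      (fun w hw => hw _ (by omega)) (by simp [hu (k - n) (by omega)])
    have hq : ∀ n w, (q n).1 w = w + w (k - n) • u := fun _ _ => rfl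
    refine hg (apply_eq_zero_of_injective hf (q := q) (fun n => mem_Qbar_iff.2 fun w _ => ?_) ?_)
    · rw [hq, add_sub_cancel_left]
      exact Submodule.smul_mem _ _ (high_mem_W hv)
    · intro n n' hnn
      by_contra hne
      have h1 := Pbar_lo (hcoset _ _ hnn) (hk _ (basisVec_mem_W.2 (show k - n' ≤ k by omega)))
      rw [mul_val_apply, mul_val_apply, mul_val_apply, val_apply_inv_self, hq, basisVec_same,
        one_smul] at h1
      have h2 : (q n).1 (basisVec F (k - n') + u) = basisVec F (k - n') + u := by
        rw [hq, SeqSpace.add_apply, hu _ (by omega), basisVec_of_ne (by omega)]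
        simp
      have h3 : ((q n)⁻¹).1 (basisVec F (k - n') + u) = basisVec F (k - n') + u := by
        conv_lhs => rw [← h2]
        rw [inv_val_apply_self]
      rw [h3, map_add] at h1
      exact hgu ((Submodule.add_mem_iff_right _
        (hk _ (basisVec_mem_W.2 (by omega)))).1 h1)
  · by_contra! hcon
    obtain ⟨v, hv, hgv⟩ := hcon
    obtain ⟨i, hi, hvi⟩ : ∃ i, β.hi < i ∧ (g.1 v) i ≠ 0 := by
      by_contra! h
      exact hgv fun j hj => h j hj
    obtain ⟨l, hl⟩ := exists_map_W_le g.1 α.hi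
    have hil : i ≤ l := by
      by_contra! h
      exact hvi (hl v hv i h)
    -- Since `i > β.hi`, these fix `W β.hi` pointwise. They move g v to a new coordinate above `l`,
    -- different for each n, whereas g(`W α.hi`) lies in `W l`.
    let q : ℕ → GLbar F := fun n => shear (coord F i) (basisVec F (l + 1 + n)) β.hi
      (fun w hw => hw _ hi) (by
        rw [coord_apply, basisVec_of_ne (by omega), add_zero]
        exact one_ne_zero)
    have hq : ∀ n w, (q n).1 w = w + w i • basisVec F (l + 1 + n) := fun _ _ => rfl
    refine hg (apply_eq_zero_of_injective hf (q := q) (fun n => mem_Qbar_iff.2 fun w hw => ?_) ?_)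
    · rw [hq, hw i hi, zero_smul, add_zero, sub_self]
      exact zero_mem _
    · intro n n' hnn
      by_contra hne
      have h1 := hl _ (Pbar_hi (hcoset _ _ hnn) hv)
      rw [mul_val_apply, mul_val_apply, mul_val_apply, val_apply_inv_self] at h1
      set z := ((q n)⁻¹).1 ((q n').1 (g.1 v)) with hz
      have h2 : (q n).1 z = (q n').1 (g.1 v) := by rw [hz, val_apply_inv_self]
      have h3 := congrArg (fun w : SeqSpace F => w (l + 1 + n')) h2
      simp only [hq, SeqSpace.add_apply, SeqSpace.smul_apply, basisVec_same, mul_one] at h3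
      rw [h1 _ (by omega), hl v hv _ (by omega), basisVec_of_ne (by omega), mul_zero, zero_add,
        zero_add] at h3
      exact hvi h3.symm

/-- For β = α the two inclusions of `between_of_apply_ne_zero` become equalities by volume, so the
support is the base point. -/
theorem mem_fixedVectors_Qbar_iff (f : IndSpace (Pbar F α) L) :
    f ∈ fixedVectors (inducedFromBlock α τ) (Qbar F α) ↔
      ∃ v, indSingle (Pbar F α) ((1 : GLbar F) : GLbar F ⧸ Pbar F α) v = f := by
  constructor
  · intro hf
    refine ⟨_, (eq_indSingle fun x hx => ?_).symm⟩
    by_contra hfx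
    rw [← mk_cosetRep _ x] at hfx hx
    have h1 := between_of_apply_ne_zero hf hfx
    refine hx ?_
    have h2 : cosetRep (Pbar F α) x ∈ Pbar F α := mem_Pbar_of_forall (fun v hv => by
      have := inv_mem_W_of_forall h1.1 hv
      rwa [inv_inv] at this) h1.2
    rw [QuotientGroup.eq, mul_one]
    exact inv_mem h2
  · rintro ⟨v, rfl⟩
    exact indSingle_one_mem_fixedVectors τ le_rfl v

theorem separableSpace_indSpace [TopologicalSpace.SeparableSpace L] :
    TopologicalSpace.SeparableSpace (IndSpace (Pbar F α) L) := by
  have := countable_quotient_Pbar (F := F) α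
  let R : Set (IndSpace (Pbar F α) L) := ⋃ x, Set.range (indSingle (Pbar F α) (L := L) x)
  have hR : TopologicalSpace.IsSeparable R :=
    TopologicalSpace.isSeparable_iUnion.2 fun x =>
      TopologicalSpace.isSeparable_range (indSingle (Pbar F α) x).continuous
  have h1 : TopologicalSpace.IsSeparable
      ((Submodule.span ℂ R).topologicalClosure : Set (IndSpace (Pbar F α) L)) :=
    (hR.span (R := ℂ)).closure
  rw [← TopologicalSpace.isSeparable_univ_iff]
  refine h1.mono fun f _ => mem_of_indSingle_mem (Submodule.isClosed_topologicalClosure _)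
    (fun x v => Submodule.le_topologicalClosure _ (Submodule.subset_span ?_)) f
  exact Set.mem_iUnion.2 ⟨x, v, rfl⟩

/-- The orbit map is locally constant, being constant on the open cosets of Q̄_β. -/
theorem continuous_rep_apply_of_mem_fixedVectors {H : Type*} [NormedAddCommGroup H]
    [InnerProductSpace ℂ H] {ρ : GLbar F →* (H ≃ₗᵢ[ℂ] H)} {β : Seg} {h : H}
    (hh : h ∈ fixedVectors ρ (Qbar F β)) : Continuous fun g => ρ g h := by
  refine continuous_iff_continuousAt.2 fun g => ContinuousAt.congr continuousAt_const
    (f := fun _ => ρ g h) ?_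
  filter_upwards [(isOpen_setOf_inv_mul_mem_Qbar β g).mem_nhds (by simp [one_mem])] with k hk
  rw [← rep_apply_inv_self ρ g (ρ k h), ← map_mul_rep_apply ρ g⁻¹, hh _ hk]

theorem continuous_mul_right_GLbar (g : GLbar F) : Continuous fun h : GLbar F => h * g := by
  refine continuous_induced_rng.2 ?_
  exact (ContinuousMap.continuous_precomp (⟨g.1, g.1.continuous⟩ : C(SeqSpace F, SeqSpace F))).comp
    (continuous_induced_dom (f := fun g : GLbar F =>
      (⟨g.1, g.1.continuous⟩ : C(SeqSpace F, SeqSpace F))))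

/-- Vectors with continuous orbit maps form a closed subspace (an ε/3 argument), and it contains all
translates of Q̄_α-fixed vectors, which are total. -/
theorem isStronglyContinuous_inducedFromBlock : IsStronglyContinuous (inducedFromBlock α τ) := by
  let S : Submodule ℂ (IndSpace (Pbar F α) L) :=
    { carrier := {f | Continuous fun g => inducedFromBlock α τ g f}
      zero_mem' := by simpa using continuous_const
      add_mem' := fun {f f'} hf hf' => by
        refine (Continuous.add hf hf').congr fun g => ?_
        exact (map_add (inducedFromBlock α τ g) f f').symm
      smul_mem' := fun c f hf => by
        refine (Continuous.const_smul hf c).congr fun g => ?_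
        exact (map_smul (inducedFromBlock α τ g) c f).symm }
  have hS : IsClosed (S : Set (IndSpace (Pbar F α) L)) := by
    refine isClosed_of_closure_subset fun f hf => ?_
    refine continuous_iff_continuousAt.2 fun g => ?_
    rw [Metric.continuousAt_iff']
    intro ε hε
    obtain ⟨f', hf', hff⟩ := Metric.mem_closure_iff.1 hf (ε / 3) (by positivity)
    filter_upwards [Metric.continuousAt_iff'.1 (Continuous.continuousAt hf' (x := g)) (ε / 3)
      (by positivity)] with k hk
    calc dist (inducedFromBlock α τ k f) (inducedFromBlock α τ g f)
        ≤ dist (inducedFromBlock α τ k f) (inducedFromBlock α τ k f') +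
          dist (inducedFromBlock α τ k f') (inducedFromBlock α τ g f') +
          dist (inducedFromBlock α τ g f') (inducedFromBlock α τ g f) := dist_triangle4 _ _ _ _
      _ = dist f f' + dist (inducedFromBlock α τ k f') (inducedFromBlock α τ g f') + dist f f' := by
          rw [LinearIsometryEquiv.dist_map, LinearIsometryEquiv.dist_map, dist_comm f' f]
      _ < ε := by linarith
  refine fun f => mem_of_indSingle_mem hS (fun x v => ?_) f
  have h1 := (continuous_rep_apply_of_mem_fixedVectors
    (indSingle_one_mem_fixedVectors τ (le_refl α) v)).comp
    (continuous_mul_right_GLbar (cosetRep (Pbar F α) x))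
  refine h1.congr fun g => ?_
  change inducedFromBlock α τ (g * _) _ = inducedFromBlock α τ g _
  rw [map_mul_rep_apply]
  exact congrArg _ (inducedRep_cosetRep_indSingle _ _ x v)

theorem hasZeroData_inducedFromBlock [CompleteSpace L] [Nontrivial L] :
    HasZeroData (inducedFromBlock α τ) α τ where
  spherical := by
    intro β f hf
    rw [Complex.ofReal_zero, zero_smul, Submodule.starProjection_apply_eq_zero_iff,
      Submodule.mem_orthogonal']
    intro f' hf'
    rw [lp.inner_eq_tsum]
    refine (tsum_congr fun x => ?_).trans tsum_zero
    by_contra hne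
    have h1 : f' x ≠ 0 := fun h => hne (by rw [h, inner_zero_right])
    have h2 : f ((zetaElt F β)⁻¹ • x) ≠ 0 := fun h => hne (by
      change inner ℂ ((inducedRep _ _ (zetaElt F β) f) x) _ = 0
      rw [inducedRep_apply, h, map_zero, inner_zero_left])
    obtain ⟨g, rfl⟩ := QuotientGroup.mk_surjective x
    rw [MulAction.Quotient.smul_coe, smul_eq_mul] at h2
    have h3 := (between_of_apply_ne_zero hf' h1).2
    -- If the supports of T(ζ)f and f' met at gP̄_α, then e_{β.hi+1} = ζe_{β.lo} would lie in g(`W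
    -- α.lo`), hence in `W β.hi`, which is false.
    have h4 := (between_of_apply_ne_zero hf h2).1 _ (basisVec_mem_W.2 (le_refl β.lo))
    rw [mul_inv_rev, inv_inv, mul_val_apply] at h4
    have h5 : (zetaElt F β).1 (basisVec F β.lo) = basisVec F (β.hi + 1) := by
      ext j
      change (basisVec F β.lo) (Equiv.swap β.lo (β.hi + 1) j) = _
      simp only [basisVec_apply, Equiv.swap_apply_eq_iff, Equiv.swap_apply_left]
    have h6 := h3 _ (W_mono α.le h4)
    rw [val_apply_inv_self, h5, basisVec_mem_W] at h6
    omega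
  xi_eq := by
    ext β
    constructor
    · intro h
      obtain ⟨f, hf, hf0⟩ := (Submodule.ne_bot_iff _).1 h
      obtain ⟨x, hx⟩ : ∃ x, f x ≠ 0 := by
        by_contra! hcon
        exact hf0 (lp.ext (funext hcon))
      obtain ⟨g, rfl⟩ := QuotientGroup.mk_surjective x
      have h1 := between_of_apply_ne_zero hf hx
      exact ⟨le_of_map_W_le h1.1, le_of_map_W_le h1.2⟩
    · intro h
      obtain ⟨v, hv⟩ := exists_ne (0 : L)
      refine (Submodule.ne_bot_iff _).2 ⟨_, indSingle_one_mem_fixedVectors τ h v, fun h0 => hv ?_⟩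
      rwa [← norm_eq_zero, LinearIsometry.norm_map, norm_eq_zero] at h0
  equiv := by
    let J : L →ₗᵢ[ℂ] fixedVectors (inducedFromBlock α τ) (Qbar F α) :=
      { toLinearMap := (indSingle (Pbar F α) ((1 : GLbar F) : GLbar F ⧸ Pbar F α)).toLinearMap.codRestrict
          _ (indSingle_one_mem_fixedVectors τ le_rfl)
        norm_map' := fun v => LinearIsometry.norm_map (indSingle (Pbar F α) _) v }
    have hJ : Function.Surjective J := fun ⟨f, hf⟩ => by
      obtain ⟨v, hv⟩ := (mem_fixedVectors_Qbar_iff τ f).1 hf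
      exact ⟨v, Subtype.ext hv⟩
    exact ⟨LinearIsometryEquiv.ofSurjective J hJ, fun p v =>
      (inducedRep_indSingle_of_mem (Pbar F α) (τ.comp (blockHom F α)) p v).symm⟩

end InducedFromBlock

end

theorem proposition1p9 {F : Type*} [Field F] [Finite F] (α : Seg)
    {L : Type*} [NormedAddCommGroup L] [InnerProductSpace ℂ L] [CompleteSpace L]
    (τ : Matrix.GeneralLinearGroup (Fin α.len) F →* (L ≃ₗᵢ[ℂ] L)) (hτ : IsIrreducibleRep τ) :
    (TopologicalSpace.SeparableSpace (IndSpace (Pbar F α) L) ∧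
      IsStronglyContinuous (inducedFromBlock α τ) ∧
      IsIrreducibleRep (inducedFromBlock α τ) ∧
      HasZeroData (inducedFromBlock α τ) α τ) ∧
    ∀ {H : Type*} [NormedAddCommGroup H] [InnerProductSpace ℂ H] [CompleteSpace H]
      (ρ : GLbar F →* (H ≃ₗᵢ[ℂ] H)),
      IsStronglyContinuous ρ → IsIrreducibleRep ρ → HasZeroData ρ α τ →
        UnitarilyEquivalent ρ (inducedFromBlock α τ) := by
  have hL : Nontrivial L := hτ.1
  -- The group GL(|α|, F) is finite, so `L` is finite-dimensional; this supplies the separability of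
  -- `L`.
  have hfin : FiniteDimensional ℂ L := finiteDimensional_of_irreducible hτ
  have hproper : ProperSpace L := FiniteDimensional.proper ℂ L
  refine ⟨⟨separableSpace_indSpace, isStronglyContinuous_inducedFromBlock τ, ?_,
    hasZeroData_inducedFromBlock τ⟩, ?_⟩
  · exact inducedRep_irreducible _ _ (isIrreducibleRep_comp hτ (blockHom_surjective α))
      (mem_fixedVectors_Qbar_iff τ)
  · intro H _ _ _ ρ hρ hirr hdata
    obtain ⟨U, hU⟩ := hdata.equiv
    exact unitarilyEquivalent_inducedRep hirr ((Submodule.subtypeₗᵢ _).comp U.toLinearIsometry)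
      hU fun g hg v w =>
        inner_eq_zero_of_notMem_Pbar hρ hdata.xi_eq (U v).2 (U w).2 hg
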